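/- Let $G$ be a finite abelian group and let $k$ be a field whose characteristic does not divide $|G|$ and which contains a primitive root of unity of order the exponent of $G$. Let $\widehat G=\operatorname{Hom}(G,k^\times)$ be the character group of $G$. Let $\Lambda$ be a finite-dimensional $k$-algebra on which $G$ acts by $k$-algebra automorphisms, and let $\Lambda G=\Lambda\otimes_k kG$ be the skew group algebra, with multiplication $(\lambda\otimes g)(\mu\otimes h)=\lambda\, g(\mu)\otimes gh$; the group $\widehat G$ acts on $\Lambda G$ by algebra automorphisms via $\chi(\lambda\otimes g)=\chi(g)\lambda\otimes g$. For a finite-dimensional $k$-algebra $A$, let $\mathcal D^b(A)$ be the bounded derived category of finite-dimensional right $A$-modules. If a group $H$ acts on $A$ by $k$-algebra automorphisms, write $X^h=X\otimes^{\mathbf L}_A A_h$ for $X\in\mathcal D^b(A)$, $h\in H$, where $A_h$ is $A$ with its right action twisted by $h$ (so that $a\in A$ acts on the right as $h(a)$). An object $X$ is $H$-invariant if there are isomorphisms $\iota_h\colon X^{h^{-1}}\to X$, $h\in H$, with $\iota_{gh}=\iota_g\circ(\iota_h)^{g^{-1}}$ for all $g,h\in H$, where $(X^{h^{-1}})^{g^{-1}}$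 is canonically identified with $X^{(gh)^{-1}}$. An object $T$ is tilting if $\operatorname{Hom}_{\mathcal D^b(A)}(T,T[i])=0$ for all integers $i\neq0$ and the smallest triangulated subcategory of $\mathcal D^b(A)$ that contains $T$ and is closed under direct summands is $\mathcal D^b(A)$. An $H$-tilting subcategory of $\mathcal D^b(A)$ is a subcategory of the form $\operatorname{add}(T)$ (the direct summands of finite direct sums of copies of $T$), where $T$ is an $H$-invariant tilting object. Then the functor $-\otimes^{\mathbf L}_\Lambda\Lambda G\colon\mathcal D^b(\Lambda)\to\mathcal D^b(\Lambda G)$ sends $G$-invariant tilting objects to $\widehat G$-invariant tilting objects, the restriction functor $\operatorname{Res}\colon\mathcal D^b(\Lambda G)\to\mathcal D^b(\Lambda)$ sends $\widehat G$-invariant tilting objects to $G$-invariant tilting objects, and the assignments $$\operatorname{add}(T)\mapsto\operatorname{add}(T\otimes^{\mathbf L}_\Lambda\Lambda G),\qquad \operatorname{add}(U)\mapsto\operatorname{add}(\operatorname{Res}U)$$ are well defined and give mutually inverse bijections between the $G$-tilting subcategories of $\mathcal D^b(\Lambda)$ and the $\widehat G$-tilting subcategories of $\mathcal D^b(\Lambda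 G)$. -/

import Mathlib

open CategoryTheory Limits
open scoped TensorProduct

universe w w₁ w₂ v₁ v₂ u₁ u₂ u

noncomputable section

/-! ### Extension of scalars for modules over non-commutative rings -/

namespace ExtScalars

variable {R S : Type u} [Ring R] [Ring S] (f : R →+* S)

/-- The `S`-submodule of `S ⊗[ℤ] M` spanned by all `(s * f r) ⊗ m - s ⊗ (r • m)`. -/
def relations (M : Type u) [AddCommGroup M] [Module R M] : Submodule S (S ⊗[ℤ] M) :=
  Submodule.span S
    {z | ∃ (s : S) (r : R) (m : M), z = (s * f r) ⊗ₜ[ℤ] m - s ⊗ₜ[ℤ] (r • m)}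

/-- The `S`-module `S ⊗_R M`, for a ring homomorphism `f : R → S` of possibly non-commutative
rings and a left `R`-module `M`: the quotient of `S ⊗_ℤ M` by the `R`-balancing relations. -/
abbrev Obj (M : Type u) [AddCommGroup M] [Module R M] : Type u :=
  (S ⊗[ℤ] M) ⧸ relations f M

variable {M N P : Type u} [AddCommGroup M] [Module R M] [AddCommGroup N] [Module R N]
  [AddCommGroup P] [Module R P]

/-- The map `s ⊗ m ↦ s ⊗ g m` on `S ⊗_ℤ M`. -/
def preMap (g : M →ₗ[R] N) : (S ⊗[ℤ] M) →ₗ[S] (S ⊗[ℤ] N) :=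
  TensorProduct.AlgebraTensorModule.map (LinearMap.id : S →ₗ[S] S)
    (g.toAddMonoidHom.toIntLinearMap)

lemma preMap_tmul (g : M →ₗ[R] N) (s : S) (m : M) :
    preMap g (s ⊗ₜ[ℤ] m) = s ⊗ₜ[ℤ] (g m) := rfl

lemma relations_le (g : M →ₗ[R] N) :
    relations f M ≤ (relations f N).comap (preMap g) := by
  refine Submodule.span_le.2 ?_
  rintro _ ⟨s, r, m, rfl⟩
  refine Submodule.subset_span ⟨s, r, g m, ?_⟩
  rw [map_sub, preMap_tmul, preMap_tmul, map_smul]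

/-- The map `s ⊗ m ↦ s ⊗ g m` on `S ⊗_R M`. -/
def map (g : M →ₗ[R] N) : Obj f M →ₗ[S] Obj f N :=
  Submodule.mapQ _ _ (preMap g) (relations_le f g)

/-- The pure tensor `s ⊗ m` of `S ⊗_R M`. -/
def tmul (s : S) (m : M) : Obj f M := Submodule.Quotient.mk (s ⊗ₜ[ℤ] m)

lemma map_tmul (g : M →ₗ[R] N) (s : S) (m : M) : map f g (tmul f s m) = tmul f s (g m) := rfl

lemma tmul_add (s : S) (m n : M) : tmul f s (m + n) = tmul f s m + tmul f s n := by
  simp only [tmul, TensorProduct.tmul_add, Submodule.Quotient.mk_add]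

lemma add_tmul (s t : S) (m : M) : tmul f (s + t) m = tmul f s m + tmul f t m := by
  simp only [tmul, TensorProduct.add_tmul, Submodule.Quotient.mk_add]

lemma smul_tmul' (s t : S) (m : M) : s • tmul f t m = tmul f (s * t) m := rfl

lemma mul_tmul (s : S) (r : R) (m : M) : tmul f (s * f r) m = tmul f s (r • m) :=
  (Submodule.Quotient.eq _).2 (Submodule.subset_span ⟨s, r, m, rfl⟩)

lemma addHom_ext {A : Type*} [AddCommGroup A] {φ ψ : Obj f M →+ A}
    (h : ∀ s m, φ (tmul f s m) = ψ (tmul f s m)) : φ = ψ := by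
  refine AddMonoidHom.ext fun z ↦ ?_
  obtain ⟨z, rfl⟩ := Submodule.Quotient.mk_surjective _ z
  induction z using TensorProduct.induction_on with
  | zero => simp
  | tmul s m => exact h s m
  | add x y hx hy => rw [Submodule.Quotient.mk_add, map_add, map_add, hx, hy]

lemma linearMap_ext {A : Type*} [AddCommGroup A] [Module S A] {φ ψ : Obj f M →ₗ[S] A}
    (h : ∀ s m, φ (tmul f s m) = ψ (tmul f s m)) : φ = ψ :=
  LinearMap.toAddMonoidHom_injective (addHom_ext f h)

lemma map_id : map f (LinearMap.id : M →ₗ[R] M) = LinearMap.id :=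
  linearMap_ext f fun _ _ ↦ rfl

lemma map_comp (g : M →ₗ[R] N) (h : N →ₗ[R] P) :
    map f (h.comp g) = (map f h).comp (map f g) :=
  linearMap_ext f fun _ _ ↦ rfl

lemma map_add' (g h : M →ₗ[R] N) : map f (g + h) = map f g + map f h :=
  linearMap_ext f fun s m ↦ tmul_add f s (g m) (h m)

/-- The additive map on `S ⊗_R M` that a balanced biadditive map on `S × M` induces. -/
def lift {A : Type*} [AddCommGroup A] (β : S →+ M →+ A)
    (hβ : ∀ s r m, β (s * f r) m = β s (r • m)) : Obj f M →+ A :=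
  QuotientAddGroup.lift (relations f M).toAddSubgroup
    (TensorProduct.liftAddHom β (fun n s m ↦ by
      rw [map_zsmul, map_zsmul, AddMonoidHom.smul_apply])) (by
      intro z hz
      have key : ∀ t : S, TensorProduct.liftAddHom (R := ℤ) β (fun n s m ↦ by
          rw [map_zsmul, map_zsmul, AddMonoidHom.smul_apply]) (t • z) = 0 := by
        refine Submodule.span_induction (p := fun z _ ↦ ∀ t : S,
          TensorProduct.liftAddHom (R := ℤ) β _ (t • z) = 0) ?_ ?_ ?_ ?_ hz
        · rintro _ ⟨s, r, m, rfl⟩ t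
          rw [smul_sub, map_sub, TensorProduct.smul_tmul', TensorProduct.smul_tmul',
            TensorProduct.liftAddHom_tmul, TensorProduct.liftAddHom_tmul, smul_eq_mul,
            smul_eq_mul, ← mul_assoc, hβ, sub_self]
        · intro t
          rw [smul_zero, map_zero]
        · intro x y _ _ hx hy t
          rw [smul_add, map_add, hx, hy, add_zero]
        · intro a x _ hx t
          rw [smul_smul, hx]
      have h1 := key 1
      rwa [one_smul] at h1)

lemma lift_tmul {A : Type*} [AddCommGroup A] (β : S →+ M →+ A)
    (hβ : ∀ s r m, β (s * f r) m = β s (r • m)) (s : S) (m : M) :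
    lift f β hβ (tmul f s m) = β s m := rfl

instance finite_obj [Module.Finite R M] : Module.Finite S (Obj f M) := by
  obtain ⟨T, hT⟩ := Module.Finite.fg_top (R := R) (M := M)
  classical
  refine ⟨⟨T.image (tmul f 1), ?_⟩⟩
  have h1 : ∀ m : M, tmul f 1 m ∈ Submodule.span S (T.image (tmul f (1 : S)) : Set (Obj f M)) := by
    intro m
    have hm : m ∈ Submodule.span R (T : Set M) := hT ▸ Submodule.mem_top
    induction hm using Submodule.span_induction with
    | mem x hx => exact Submodule.subset_span (by simpa using ⟨x, hx, rfl⟩)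
    | zero =>
      have : tmul f (1 : S) (0 : M) = 0 := by
        simpa using tmul_add f (1 : S) (0 : M) 0
      rw [this]; exact Submodule.zero_mem _
    | add x y _ _ hx hy => rw [tmul_add]; exact Submodule.add_mem _ hx hy
    | smul a x _ hx =>
      rw [← mul_tmul, one_mul, ← mul_one (f a), ← smul_tmul']
      exact Submodule.smul_mem _ _ hx
  refine Submodule.eq_top_iff'.2 fun z ↦ ?_
  obtain ⟨z, rfl⟩ := Submodule.Quotient.mk_surjective _ z
  induction z using TensorProduct.induction_on with
  | zero => exact Submodule.zero_mem _
  | tmul s m =>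
    have : (Submodule.Quotient.mk (s ⊗ₜ[ℤ] m) : Obj f M) = s • tmul f 1 m := by
      rw [smul_tmul', mul_one]; rfl
    rw [this]
    exact Submodule.smul_mem _ _ (h1 m)
  | add x y hx hy => rw [Submodule.Quotient.mk_add]; exact Submodule.add_mem _ hx hy

/-- `S` is free of finite rank as a right `R`-module via `f`: basis `b`, coordinates `c`. -/
structure RightBasis (ι : Type u) [Fintype ι] [DecidableEq ι] where
  /-- the basis vectors -/
  b : ι → S
  /-- the coordinate functions -/
  c : ι → S →+ R
  c_mul : ∀ i s r, c i (s * f r) = c i s * r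
  c_b : ∀ i j, c i (b j) = if i = j then 1 else 0
  sum_eq : ∀ s, ∑ i, b i * f (c i s) = s

namespace RightBasis

variable {f} {ι : Type u} [Fintype ι] [DecidableEq ι] (B : RightBasis f ι)

/-- The coordinate `S ⊗_R M → M`, `s ⊗ m ↦ c_i(s) • m`. -/
def coord (M : Type u) [AddCommGroup M] [Module R M] (i : ι) : Obj f M →+ M :=
  lift f ((smulAddHom R M).comp (B.c i)) (fun s r m ↦ by
    change B.c i (s * f r) • m = B.c i s • r • m
    rw [B.c_mul, mul_smul])

lemma coord_tmul (i : ι) (s : S) (m : M) : B.coord M i (tmul f s m) = B.c i s • m := rfl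

lemma coord_map (g : M →ₗ[R] N) (i : ι) (z : Obj f M) :
    B.coord N i (map f g z) = g (B.coord M i z) := by
  have : (B.coord N i).comp (map f g).toAddMonoidHom = g.toAddMonoidHom.comp (B.coord M i) :=
    addHom_ext f fun s m ↦ (g.map_smul _ _).symm
  exact DFunLike.congr_fun this z

lemma sum_coord (z : Obj f M) : ∑ i, tmul f (B.b i) (B.coord M i z) = z := by
  let T (s : S) : M →+ Obj f M := AddMonoidHom.mk' (tmul f s) (tmul_add f s)
  have : ∑ i, (T (B.b i)).comp (B.coord M i) = AddMonoidHom.id _ := by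
    refine addHom_ext f fun s m ↦ ?_
    rw [AddMonoidHom.finsetSum_apply]
    change ∑ i, tmul f (B.b i) (B.c i s • m) = tmul f s m
    let T' : S →+ Obj f M := AddMonoidHom.mk' (fun s ↦ tmul f s m) (fun s t ↦ add_tmul f s t m)
    calc ∑ i, tmul f (B.b i) (B.c i s • m) = ∑ i, T' (B.b i * f (B.c i s)) :=
          Finset.sum_congr rfl fun i _ ↦ (mul_tmul f _ _ _).symm
      _ = tmul f s m := by rw [← map_sum, B.sum_eq]; rfl
  have h := DFunLike.congr_fun this z
  rw [AddMonoidHom.finsetSum_apply] at h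
  exact h

lemma exact_map (B : RightBasis f ι) {g : M →ₗ[R] N} {h : N →ₗ[R] P} (H : Function.Exact g h) :
    Function.Exact (map f g) (map f h) := by
  intro y
  constructor
  · intro hy
    have hm (i : ι) : ∃ m, g m = B.coord N i y :=
      (H _).1 (by rw [← B.coord_map, hy, map_zero])
    choose m hm using hm
    refine ⟨∑ i, tmul f (B.b i) (m i), ?_⟩
    rw [map_sum, ← B.sum_coord y]
    exact Finset.sum_congr rfl fun i _ ↦ by rw [map_tmul, hm]
  · rintro ⟨x, rfl⟩
    rw [← LinearMap.comp_apply, ← map_comp, H.linearMap_comp_eq_zero]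
    have : map f (0 : M →ₗ[R] P) = 0 := by
      have := map_add' f (0 : M →ₗ[R] P) 0
      simpa using this
    rw [this, LinearMap.zero_apply]

end RightBasis

end ExtScalars

/-! ### Finite-dimensional right modules -/

section RMod

variable (k : Type u) [Field k]

/-- The category `mod A` of finitely generated (equivalently, finite-dimensional) right modules over
a finite-dimensional `k`-algebra `A`; right `A`-modules are modules over `Aᵐᵒᵖ`. The ground field
is recorded only because it is needed to know that the category is abelian. -/
def RMod (A : Type u) [Ring A] [Algebra k A] : Type (u + 1) :=
  FGModuleCat.{u} Aᵐᵒᵖ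

variable {A B C : Type u} [Ring A] [Algebra k A] [Ring B] [Algebra k B] [Ring C] [Algebra k C]

instance : Category.{u} (RMod k A) :=
  inferInstanceAs (Category (FGModuleCat.{u} Aᵐᵒᵖ))

lemma isNoetherianRing_op (A : Type u) [Ring A] [Algebra k A] [Module.Finite k A] :
    IsNoetherianRing Aᵐᵒᵖ :=
  isNoetherian_of_tower k inferInstance

instance [Module.Finite k A] : Abelian (RMod k A) :=
  haveI := isNoetherianRing_op k A
  inferInstanceAs (Abelian (FGModuleCat.{u} Aᵐᵒᵖ))

lemma FGModuleCat.exact_iff {R : Type u} [Ring R] [IsNoetherianRing R]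
    (T : ShortComplex (FGModuleCat.{u} R)) :
    T.Exact ↔ Function.Exact T.f.hom.hom T.g.hom.hom := by
  rw [← ShortComplex.exact_map_iff_of_faithful T (forget₂ (FGModuleCat.{u} R) (ModuleCat.{u} R)),
    ShortComplex.ShortExact.moduleCat_exact_iff_function_exact]
  rfl

lemma RMod.exact_iff [Module.Finite k A] (T : ShortComplex (RMod k A)) :
    T.Exact ↔ Function.Exact T.f.hom.hom T.g.hom.hom :=
  have := isNoetherianRing_op k A
  FGModuleCat.exact_iff (R := Aᵐᵒᵖ) T

variable {k}

/-- The ring homomorphism `Aᵐᵒᵖ → Bᵐᵒᵖ` given by an algebra homomorphism `A → B`. -/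
abbrev opHom (φ : A →ₐ[k] B) : Aᵐᵒᵖ →+* Bᵐᵒᵖ := RingHom.op (φ : A →+* B)

lemma isFG_restrictScalars [Module.Finite k B] (φ : A →ₐ[k] B) (M : ModuleCat.{u} Bᵐᵒᵖ)
    (hM : ModuleCat.isFG Bᵐᵒᵖ M) :
    ModuleCat.isFG Aᵐᵒᵖ ((ModuleCat.restrictScalars (opHom φ)).obj M) := by
  let _ : Module Aᵐᵒᵖ Bᵐᵒᵖ := Module.compHom Bᵐᵒᵖ (opHom φ)
  let _ : Module Aᵐᵒᵖ M := Module.compHom M (opHom φ)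
  have : Module.Finite Bᵐᵒᵖ M := hM
  have : IsScalarTower Aᵐᵒᵖ Bᵐᵒᵖ M := ⟨fun a b m ↦ mul_smul (opHom φ a) b m⟩
  have : IsScalarTower k Aᵐᵒᵖ Bᵐᵒᵖ := ⟨fun c a b ↦ by
    change opHom φ (c • a) * b = c • (opHom φ a * b)
    rw [← smul_mul_assoc]
    congr 1
    exact congrArg MulOpposite.op (map_smul φ c a.unop)⟩
  have : Module.Finite Aᵐᵒᵖ Bᵐᵒᵖ := Module.Finite.of_restrictScalars_finite k Aᵐᵒᵖ Bᵐᵒᵖ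
  exact Module.Finite.trans (R := Aᵐᵒᵖ) Bᵐᵒᵖ M

/-- Restriction of right modules along an algebra homomorphism `φ : A → B`:
the underlying space is unchanged and `x · a = x · φ a`. -/
def resFunctor [Module.Finite k B] (φ : A →ₐ[k] B) : RMod k B ⥤ RMod k A :=
  (ModuleCat.isFG Aᵐᵒᵖ).lift
    ((ModuleCat.isFG Bᵐᵒᵖ).ι ⋙ ModuleCat.restrictScalars (opHom φ))
    (fun M ↦ isFG_restrictScalars φ M.obj M.property)

section

variable [Module.Finite k A] [Module.Finite k B] [Module.Finite k C]

instance (φ : A →ₐ[k] B) : (resFunctor φ).Additive where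
  map_add := rfl

lemma resFunctor_exact (φ : A →ₐ[k] B) :
    PreservesFiniteLimits (resFunctor φ) ∧ PreservesFiniteColimits (resFunctor φ) :=
  ((Functor.exact_tfae (resFunctor φ)).out 1 3).1 fun T hT ↦
    (RMod.exact_iff k (T.map (resFunctor φ))).2 ((RMod.exact_iff k T).1 hT)

instance (φ : A →ₐ[k] B) : PreservesFiniteLimits (resFunctor φ) := (resFunctor_exact φ).1

instance (φ : A →ₐ[k] B) : PreservesFiniteColimits (resFunctor φ) := (resFunctor_exact φ).2

/-- The canonical isomorphism (the identity on elements) between restricting along `ψ` and then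
along `φ`, and restricting along `ψ ∘ φ`. -/
def resFunctorComp (φ : A →ₐ[k] B) (ψ : B →ₐ[k] C) (χ : A →ₐ[k] C) (h : χ = ψ.comp φ) :
    resFunctor ψ ⋙ resFunctor φ ≅ resFunctor χ :=
  NatIso.ofComponents (fun M ↦ (ModuleCat.isFG Aᵐᵒᵖ).isoMk
    (ModuleCat.restrictScalarsComp'App (opHom φ) (opHom ψ) (opHom χ)
      (by subst h; rfl) M.obj).symm) (fun _ ↦ rfl)

end

/-- Extension of scalars `- ⊗_A B : mod A ⥤ mod B` of right modules along an algebra homomorphism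
`φ : A → B`. For a right `A`-module `X` it is the quotient of `B ⊗_ℤ X` by the relations
`(φ a * b) ⊗ x = b ⊗ (x · a)`, with `B` acting by right multiplication on the factor `B`. -/
def indFunctor (φ : A →ₐ[k] B) : RMod k A ⥤ RMod k B where
  obj M :=
    have : Module.Finite Aᵐᵒᵖ (FGModuleCat.carrier M) := M.property
    FGModuleCat.of Bᵐᵒᵖ (ExtScalars.Obj (opHom φ) (FGModuleCat.carrier M))
  map g := ObjectProperty.homMk (ModuleCat.ofHom (ExtScalars.map (opHom φ) g.hom.hom))
  map_id _ := FGModuleCat.hom_ext (ExtScalars.map_id (opHom φ))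
  map_comp g h := FGModuleCat.hom_ext (ExtScalars.map_comp (opHom φ) g.hom.hom h.hom.hom)

section

variable [Module.Finite k A] [Module.Finite k B]

instance (φ : A →ₐ[k] B) : (indFunctor φ).Additive where
  map_add {M N g h} := FGModuleCat.hom_ext (R := Bᵐᵒᵖ)
    (ExtScalars.map_add' (opHom φ) (M := FGModuleCat.carrier M) (N := FGModuleCat.carrier N)
      g.hom.hom h.hom.hom)

lemma indFunctor_exact (φ : A →ₐ[k] B) {ι : Type u} [Fintype ι] [DecidableEq ι]
    (b : ExtScalars.RightBasis (opHom φ) ι) :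
    PreservesFiniteLimits (indFunctor φ) ∧ PreservesFiniteColimits (indFunctor φ) :=
  ((Functor.exact_tfae (indFunctor φ)).out 1 3).1 fun T hT ↦
    (RMod.exact_iff k (T.map (indFunctor φ))).2 (b.exact_map ((RMod.exact_iff k T).1 hT))

end

end RMod

/-! ### Skew group algebras -/

section SkewGroup

variable (k Λ G : Type u) [Field k] [Ring Λ] [Algebra k Λ] [CommGroup G]
  [MulSemiringAction G Λ] [SMulCommClass G k Λ]

instance [Finite G] [Module.Finite k Λ] : Module.Finite k (SkewMonoidAlgebra Λ G) :=
  Module.Finite.equiv (SkewMonoidAlgebra.coeffLinearEquiv (S := k) (k := Λ) (G := G)).symm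

/-- The inclusion `Λ → ΛG`, `λ ↦ λ ⊗ 1`. -/
def skewIncl : Λ →ₐ[k] SkewMonoidAlgebra Λ G :=
  { SkewMonoidAlgebra.singleOneRingHom with
    commutes' := fun _ ↦ rfl }

/-- `ΛG` is free as a left `Λ`-module on the elements `1 ⊗ g`. -/
def skewBasis [Fintype G] [DecidableEq G] :
    ExtScalars.RightBasis (opHom (skewIncl k Λ G)) G where
  b g := MulOpposite.op (SkewMonoidAlgebra.single g 1)
  c g := AddMonoidHom.mk' (fun s ↦ MulOpposite.op (s.unop.coeff g)) (fun s t ↦ by simp)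
  c_mul g s r := by
    change MulOpposite.op ((SkewMonoidAlgebra.single 1 r.unop * s.unop).coeff g) = _
    rw [SkewMonoidAlgebra.coeff_single_one_mul]
    rfl
  c_b g h := by
    change MulOpposite.op ((SkewMonoidAlgebra.single h (1 : Λ)).coeff g) = _
    rw [SkewMonoidAlgebra.coeff_single_apply]
    simp only [eq_comm (a := h)]
    split_ifs <;> rfl
  sum_eq s := by
    apply MulOpposite.unop_injective
    rw [Finset.unop_sum]
    have h (g : G) : SkewMonoidAlgebra.single (1 : G) (s.unop.coeff g) *
        SkewMonoidAlgebra.single g (1 : Λ) = SkewMonoidAlgebra.single g (s.unop.coeff g) := by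
      rw [SkewMonoidAlgebra.single_mul_single, one_mul, one_smul, mul_one]
    refine (Finset.sum_congr rfl fun g _ ↦ h g).trans ?_
    exact (Finsupp.sum_fintype s.unop.coeff _ fun g ↦ SkewMonoidAlgebra.single_zero g).symm.trans
      (SkewMonoidAlgebra.sum_single s.unop)

variable {k Λ G} in
lemma skewInd_exact [Finite G] [Module.Finite k Λ] :
    PreservesFiniteLimits (indFunctor (skewIncl k Λ G)) ∧
      PreservesFiniteColimits (indFunctor (skewIncl k Λ G)) := by
  classical
  have := Fintype.ofFinite G
  exact indFunctor_exact _ (skewBasis k Λ G)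

instance [Finite G] [Module.Finite k Λ] :
    PreservesFiniteLimits (indFunctor (skewIncl k Λ G)) := skewInd_exact.1

instance [Finite G] [Module.Finite k Λ] :
    PreservesFiniteColimits (indFunctor (skewIncl k Λ G)) := skewInd_exact.2

/-- The endomorphism `λ ⊗ g ↦ χ(g) λ ⊗ g` of `ΛG`. -/
def charHom (χ : G →* kˣ) : SkewMonoidAlgebra Λ G →ₐ[k] SkewMonoidAlgebra Λ G :=
  SkewMonoidAlgebra.liftNCAlgHom (skewIncl k Λ G)
    { toFun := fun g ↦ SkewMonoidAlgebra.single g ((χ g : k) • (1 : Λ))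
      map_one' := by simp
      map_mul' := fun g h ↦ by
        rw [SkewMonoidAlgebra.single_mul_single, smul_comm g (χ h : k), smul_one, map_mul,
          Units.val_mul, smul_mul_smul_comm, mul_one] }
    (fun {x g} ↦ by
      change SkewMonoidAlgebra.single 1 (g • x) *
        SkewMonoidAlgebra.single g ((χ g : k) • (1 : Λ)) =
        SkewMonoidAlgebra.single g ((χ g : k) • (1 : Λ)) * SkewMonoidAlgebra.single 1 x
      rw [SkewMonoidAlgebra.single_mul_single, SkewMonoidAlgebra.single_mul_single]
      simp)

lemma charHom_single (χ : G →* kˣ) (g : G) (x : Λ) :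
    charHom k Λ G χ (SkewMonoidAlgebra.single g x) =
      SkewMonoidAlgebra.single g ((χ g : k) • x) := by
  have : charHom k Λ G χ (SkewMonoidAlgebra.single g x) =
      SkewMonoidAlgebra.single 1 x * SkewMonoidAlgebra.single g ((χ g : k) • (1 : Λ)) :=
    SkewMonoidAlgebra.liftNC_single _ _ _ _
  rw [this, SkewMonoidAlgebra.single_mul_single]
  simp

variable {k Λ G} in
lemma skewAlgHom_ext {φ ψ : SkewMonoidAlgebra Λ G →ₐ[k] SkewMonoidAlgebra Λ G}
    (h : ∀ g x, φ (SkewMonoidAlgebra.single g x) = ψ (SkewMonoidAlgebra.single g x)) : φ = ψ :=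
  AlgHom.toLinearMap_injective (SkewMonoidAlgebra.lhom_ext h)

/-- The action of the character group `Ĝ = Hom(G, kˣ)` on `ΛG` by algebra automorphisms,
`χ(λ ⊗ g) = χ(g) λ ⊗ g`. -/
def dualAction : (G →* kˣ) →* (SkewMonoidAlgebra Λ G ≃ₐ[k] SkewMonoidAlgebra Λ G) :=
  (AlgEquiv.algHomUnitsEquiv k (SkewMonoidAlgebra Λ G)).toMonoidHom.comp
    (MonoidHom.toHomUnits
      { toFun := charHom k Λ G
        map_one' := skewAlgHom_ext fun g x ↦ by simp [charHom_single]
        map_mul' := fun χ ψ ↦ skewAlgHom_ext fun g x ↦ by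
          simp [charHom_single, mul_smul] })

lemma dualAction_single (χ : G →* kˣ) (g : G) (x : Λ) :
    dualAction k Λ G χ (SkewMonoidAlgebra.single g x) =
      SkewMonoidAlgebra.single g ((χ g : k) • x) :=
  charHom_single k Λ G χ g x

end SkewGroup

/-! ### Functors between bounded derived categories -/

section Derived

variable {C : Type u₁} [Category.{v₁} C] [Abelian C] [HasDerivedCategory.{w₁} C]
  {D : Type u₂} [Category.{v₂} D] [Abelian D] [HasDerivedCategory.{w₂} D]

lemma bounded_mapDerivedCategory (F : C ⥤ D) [F.Additive] [PreservesFiniteLimits F]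
    [PreservesFiniteColimits F] (X : DerivedCategory.Bounded C) :
    (DerivedCategory.TStructure.t (C := D)).bounded (F.mapDerivedCategory.obj X.obj) := by
  obtain ⟨⟨a, K, e, hK⟩, ⟨b, L, e', hL⟩⟩ := X.property
  refine ⟨⟨a, (F.mapHomologicalComplex _).obj K,
    F.mapDerivedCategory.mapIso e ≪≫ F.mapDerivedCategoryFactors.app K, ?_⟩,
    ⟨b, (F.mapHomologicalComplex _).obj L,
    F.mapDerivedCategory.mapIso e' ≪≫ F.mapDerivedCategoryFactors.app L, ?_⟩⟩ <;>
  infer_instance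

/-- The functor `D^b(C) ⥤ D^b(D)` given by an exact functor `F : C ⥤ D` (applying `F` to complexes
degreewise; for an exact functor this is its left and its right derived functor). -/
def mapBounded (F : C ⥤ D) [F.Additive] [PreservesFiniteLimits F]
    [PreservesFiniteColimits F] : DerivedCategory.Bounded C ⥤ DerivedCategory.Bounded D :=
  ObjectProperty.lift _ (DerivedCategory.Bounded.ι ⋙ F.mapDerivedCategory)
    (bounded_mapDerivedCategory F)

/-- An isomorphism `F ⋙ F' ≅ F''` of exact functors induces an isomorphism of the functors on
derived categories. -/
def mapDerivedComp {E : Type*} [Category* E] [Abelian E] [HasDerivedCategory E]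
    {F : C ⥤ D} {F' : D ⥤ E} {F'' : C ⥤ E}
    [F.Additive] [PreservesFiniteLimits F] [PreservesFiniteColimits F]
    [F'.Additive] [PreservesFiniteLimits F'] [PreservesFiniteColimits F']
    [F''.Additive] [PreservesFiniteLimits F''] [PreservesFiniteColimits F'']
    (e : F ⋙ F' ≅ F'') :
    F.mapDerivedCategory ⋙ F'.mapDerivedCategory ≅ F''.mapDerivedCategory :=
  letI : Localization.Lifting DerivedCategory.Q
      (HomologicalComplex.quasiIso C (ComplexShape.up ℤ))
      ((F ⋙ F').mapHomologicalComplex (ComplexShape.up ℤ) ⋙ DerivedCategory.Q)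
      (F.mapDerivedCategory ⋙ F'.mapDerivedCategory) :=
    ⟨(Functor.associator _ _ _).symm ≪≫
      Functor.isoWhiskerRight F.mapDerivedCategoryFactors F'.mapDerivedCategory ≪≫
      Functor.associator _ _ _ ≪≫
      Functor.isoWhiskerLeft (F.mapHomologicalComplex (ComplexShape.up ℤ))
        F'.mapDerivedCategoryFactors⟩
  Localization.liftNatIso DerivedCategory.Q (HomologicalComplex.quasiIso C (ComplexShape.up ℤ))
    ((F ⋙ F').mapHomologicalComplex (ComplexShape.up ℤ) ⋙ DerivedCategory.Q)
    (F''.mapHomologicalComplex (ComplexShape.up ℤ) ⋙ DerivedCategory.Q)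
    (F.mapDerivedCategory ⋙ F'.mapDerivedCategory) F''.mapDerivedCategory
    (Functor.isoWhiskerRight (NatIso.mapHomologicalComplex e _) DerivedCategory.Q)

/-- The same isomorphism on bounded derived categories. -/
def mapBoundedComp {E : Type*} [Category* E] [Abelian E] [HasDerivedCategory E]
    {F : C ⥤ D} {F' : D ⥤ E} {F'' : C ⥤ E}
    [F.Additive] [PreservesFiniteLimits F] [PreservesFiniteColimits F]
    [F'.Additive] [PreservesFiniteLimits F'] [PreservesFiniteColimits F']
    [F''.Additive] [PreservesFiniteLimits F''] [PreservesFiniteColimits F'']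
    (e : F ⋙ F' ≅ F'') :
    mapBounded F ⋙ mapBounded F' ≅ mapBounded F'' :=
  NatIso.ofComponents (fun X ↦ ObjectProperty.isoMk _ ((mapDerivedComp e).app X.obj))
    (fun f ↦ ObjectProperty.hom_ext _ ((mapDerivedComp e).hom.naturality f.hom))

end Derived

/-! ### Tilting objects in triangulated categories -/

section Tilting

open Pretriangulated

variable {D : Type u₁} [Category.{v₁} D] [Preadditive D] [HasZeroObject D] [HasShift D ℤ]
  [∀ n : ℤ, (shiftFunctor D n).Additive] [Pretriangulated D]

/-- `thick(T)`: the smallest full triangulated subcategory that contains `T` and is closed under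
direct summands. -/
def thick (T : D) : ObjectProperty D := fun X ↦
  ∀ P : ObjectProperty D, P.IsTriangulated → P.IsStableUnderRetracts → P T → P X

/-- `T` is tilting: it generates `D` as a thick subcategory, and `Hom(T, T[i]) = 0` for `i ≠ 0`. -/
def IsTilting (T : D) : Prop :=
  thick T = ⊤ ∧ ∀ i : ℤ, i ≠ 0 → ∀ f : T ⟶ T⟦i⟧, f = 0

/-- `add(T)`: the direct summands of finite direct sums of copies of `T`. -/
def addClosure (T : D) : ObjectProperty D := fun X ↦
  ∃ n : ℕ, Nonempty (Retract X (⨁ fun _ : Fin n ↦ T))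

end Tilting

/-! ### Invariant objects and invariant tilting subcategories -/

section Invariant

variable (k : Type u) [Field k] (A : Type u) [Ring A] [Algebra k A] [Module.Finite k A]
  [HasDerivedCategory.{w} (RMod k A)]

/-- The bounded derived category `D^b(mod A)`. -/
abbrev Db : Type (u + 1) := DerivedCategory.Bounded (RMod k A)

variable {k A}

/-- The functor `X ↦ X^σ = X ⊗^L_A A_σ` on `D^b(mod A)`, for an automorphism `σ` of `A`. Here `A_σ`
is `A` with right action twisted by `σ`, and `X ⊗_A A_σ` is identified, by `x ⊗ a ↦ x · a`, with the
space `X` on which `a ∈ A` acts as `x · σ a`. -/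
def twist (σ : A ≃ₐ[k] A) : Db k A ⥤ Db k A := mapBounded (resFunctor (σ : A →ₐ[k] A))

/-- The canonical isomorphism `(X^σ)^τ ≅ X^{στ}`. -/
def twistComp (σ τ υ : A ≃ₐ[k] A) (h : υ = σ * τ) : twist σ ⋙ twist τ ≅ twist υ :=
  mapBoundedComp (resFunctorComp (τ : A →ₐ[k] A) (σ : A →ₐ[k] A) (υ : A →ₐ[k] A)
    (by subst h; rfl))

variable {H : Type*} [Group H] (ρ : H →* (A ≃ₐ[k] A))

/-- `X` is `H`-invariant for an action `ρ` of `H` on `A`: there are isomorphisms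
`ι_g : X^{g⁻¹} ≅ X` with `ι_{gh} = ι_g ∘ (ι_h)^{g⁻¹}` for all `g, h` in `H`. -/
def IsInvariantObj (X : Db k A) : Prop :=
  ∃ ι : ∀ g : H, (twist (ρ g⁻¹)).obj X ≅ X, ∀ g h : H,
    (twistComp (ρ h⁻¹) (ρ g⁻¹) (ρ (g * h)⁻¹) (by rw [mul_inv_rev, map_mul])).hom.app X ≫
      (ι (g * h)).hom = (twist (ρ g⁻¹)).map (ι h).hom ≫ (ι g).hom

/-- The `H`-invariant tilting objects of `D^b(mod A)`. -/
def IsInvariantTilting (T : Db k A) : Prop := IsTilting T ∧ IsInvariantObj ρ T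

/-- The `H`-tilting subcategories of `D^b(mod A)`: the subcategories `add(T)` for `T` an
`H`-invariant tilting object. -/
def TiltingSubcat : Set (ObjectProperty (Db k A)) :=
  {P | ∃ T, IsInvariantTilting ρ T ∧ P = addClosure T}

end Invariant

section SkewFunctors

variable (k Λ G : Type u) [Field k] [Ring Λ] [Algebra k Λ] [Module.Finite k Λ] [CommGroup G]
  [Finite G] [MulSemiringAction G Λ] [SMulCommClass G k Λ]
  [HasDerivedCategory.{w₁} (RMod k Λ)] [HasDerivedCategory.{w₂} (RMod k (SkewMonoidAlgebra Λ G))]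

/-- The functor `- ⊗^L_Λ ΛG : D^b(Λ) ⥤ D^b(ΛG)`; as `ΛG` is free as a left `Λ`-module, it is
computed by applying the exact functor `- ⊗_Λ ΛG` degreewise. -/
def skewInd : Db k Λ ⥤ Db k (SkewMonoidAlgebra Λ G) := mapBounded (indFunctor (skewIncl k Λ G))

/-- The restriction functor `Res : D^b(ΛG) ⥤ D^b(Λ)`. -/
def skewRes : Db k (SkewMonoidAlgebra Λ G) ⥤ Db k Λ := mapBounded (resFunctor (skewIncl k Λ G))

end SkewFunctors

end

noncomputable section

/-! Write `F` for induction and `R` for restriction; both are exact, so everything is proved for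
modules and carried over degreewise. For a `Λ`-module `M`, the basis of group elements splits `R (F
M)` into the twists of `M` by `g ∈ G` (`sum_coordNat_basisNat`). For a `ΛG`-module `N`, the maps `n
↦ ∑ g, n g⁻¹ ⊗ (χ(g)⁻¹ / |G|) g` split `F (R N)` into the twists of `N` by characters, by
orthogonality of characters (`sum_charProjection_charInclusion`). The summands at `1 ∈ G` and at the
trivial character make the identity a retract of both composites.

If `T` is invariant, its twists are isomorphic to `T`, so `R (F T)` lies in `add T`; with the
retraction, `add (R (F T)) = add T`, and likewise for `F (R U)`.

Tilting passes to `F T` (`IsTilting.map`). The functor `R` is faithful, as the identity is a retract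
of `F ∘ R`, and it sends maps `F T ⟶ (F T)[i]` to maps between objects of `add T` and `(add T)[i]`,
which vanish. A thick subcategory containing `F T` has a thick preimage under `F` containing `T`, so
it contains every `F (R Y)` and its summand `Y`. The roles of `F` and `R` are symmetric.

Invariance of the images is automatic: characters fix `Λ ⊆ ΛG`, so they act on the second factor of
`M ⊗ ΛG`; the action of `g` on `Λ` is inner in `ΛG`, so right multiplication by `g` gives the
isomorphisms for `R N`. The cocycle identities hold on modules and descend to complexes by
`mapBoundedComp_assoc`. -/

lemma CategoryTheory.comp_eq_comp_of_squares {C : Type*} [Category* C] {X Y Y' Z Z' W V : C}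
    {b : X ⟶ Y} {q₁ : Y ⟶ Z} {q₂ : Z ⟶ W} {c : X ⟶ Y'} {b' : Y' ⟶ Z'} {q₃ : Y ⟶ Z'}
    {q₄ : Z' ⟶ W} (h : c ≫ b' = b ≫ q₃) (h' : q₁ ≫ q₂ = q₃ ≫ q₄) (r : W ⟶ V) :
    b ≫ q₁ ≫ q₂ ≫ r = c ≫ b' ≫ q₄ ≫ r := by
  rw [reassoc_of% h, reassoc_of% h']

/-! ### Transformations and composites of exact functors on derived categories -/

section DerivedTransformations

variable {C : Type u₁} [Category.{v₁} C] [Abelian C] [HasDerivedCategory.{w₁} C]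
  {D : Type u₂} [Category.{v₂} D] [Abelian D] [HasDerivedCategory.{w₂} D]

/-- A natural transformation of exact functors induces one of the functors on derived
categories. -/
def mapDerivedNat {F F' : C ⥤ D}
    [F.Additive] [PreservesFiniteLimits F] [PreservesFiniteColimits F]
    [F'.Additive] [PreservesFiniteLimits F'] [PreservesFiniteColimits F'] (α : F ⟶ F') :
    F.mapDerivedCategory ⟶ F'.mapDerivedCategory :=
  Localization.liftNatTrans DerivedCategory.Q (HomologicalComplex.quasiIso C (ComplexShape.up ℤ))
    (F.mapHomologicalComplex (ComplexShape.up ℤ) ⋙ DerivedCategory.Q)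
    (F'.mapHomologicalComplex (ComplexShape.up ℤ) ⋙ DerivedCategory.Q)
    _ _ (Functor.whiskerRight (NatTrans.mapHomologicalComplex α _) DerivedCategory.Q)

section

variable {F F' F'' : C ⥤ D}
    [F.Additive] [PreservesFiniteLimits F] [PreservesFiniteColimits F]
    [F'.Additive] [PreservesFiniteLimits F'] [PreservesFiniteColimits F']
    [F''.Additive] [PreservesFiniteLimits F''] [PreservesFiniteColimits F'']

/-- Transformations out of a localization are determined by their values on complexes, so this
formula reduces functoriality and additivity in `α` to complexes. -/
lemma mapDerivedNat_app (α : F ⟶ F') (K : CochainComplex C ℤ) :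
    (mapDerivedNat α).app (DerivedCategory.Q.obj K) =
      F.mapDerivedCategoryFactors.hom.app K ≫
        DerivedCategory.Q.map ((NatTrans.mapHomologicalComplex α _).app K) ≫
          F'.mapDerivedCategoryFactors.inv.app K :=
  Localization.liftNatTrans_app _ _ _ _ _ _ _ _

lemma mapDerivedNat_id : mapDerivedNat (𝟙 F) = 𝟙 F.mapDerivedCategory := by
  refine Localization.natTrans_ext DerivedCategory.Q
    (HomologicalComplex.quasiIso C (ComplexShape.up ℤ)) fun K ↦ ?_
  rw [mapDerivedNat_app, NatTrans.mapHomologicalComplex_id]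
  simp

lemma mapDerivedNat_comp (α : F ⟶ F') (β : F' ⟶ F'') :
    mapDerivedNat (α ≫ β) = mapDerivedNat α ≫ mapDerivedNat β := by
  refine Localization.natTrans_ext DerivedCategory.Q
    (HomologicalComplex.quasiIso C (ComplexShape.up ℤ)) fun K ↦ ?_
  rw [NatTrans.comp_app, mapDerivedNat_app, mapDerivedNat_app, mapDerivedNat_app,
    NatTrans.mapHomologicalComplex_comp]
  simp

lemma mapDerivedNat_add (α β : F ⟶ F') :
    mapDerivedNat (α + β) = mapDerivedNat α + mapDerivedNat β := by
  refine Localization.natTrans_ext DerivedCategory.Q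
    (HomologicalComplex.quasiIso C (ComplexShape.up ℤ)) fun K ↦ ?_
  have h : (NatTrans.mapHomologicalComplex (α + β) (ComplexShape.up ℤ)).app K =
      (NatTrans.mapHomologicalComplex α (ComplexShape.up ℤ)).app K +
        (NatTrans.mapHomologicalComplex β (ComplexShape.up ℤ)).app K := rfl
  rw [NatTrans.app_add, mapDerivedNat_app, mapDerivedNat_app, mapDerivedNat_app, h,
    Functor.map_add, Preadditive.add_comp, Preadditive.comp_add]

/-- A natural transformation of exact functors induces one of the functors on bounded derived
categories. -/
def mapBoundedNat (α : F ⟶ F') : mapBounded F ⟶ mapBounded F' where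
  app X := ObjectProperty.homMk ((mapDerivedNat α).app X.obj)
  naturality _ _ f := ObjectProperty.hom_ext _ ((mapDerivedNat α).naturality f.hom)

lemma mapBoundedNat_id : mapBoundedNat (𝟙 F) = 𝟙 (mapBounded F) := by
  ext X
  exact NatTrans.congr_app mapDerivedNat_id X.obj

lemma mapBoundedNat_comp (α : F ⟶ F') (β : F' ⟶ F'') :
    mapBoundedNat (α ≫ β) = mapBoundedNat α ≫ mapBoundedNat β := by
  ext X
  exact NatTrans.congr_app (mapDerivedNat_comp α β) X.obj

lemma mapBoundedNat_add (α β : F ⟶ F') :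
    mapBoundedNat (α + β) = mapBoundedNat α + mapBoundedNat β := by
  ext X
  exact NatTrans.congr_app (mapDerivedNat_add α β) X.obj

/-- Carries a decomposition `∑ p i ≫ j i = 𝟙` of module functors over to derived categories. -/
lemma mapBoundedNat_sum {ι : Type*} (s : Finset ι) (α : ι → (F ⟶ F')) :
    mapBoundedNat (∑ i ∈ s, α i) = ∑ i ∈ s, mapBoundedNat (α i) :=
  map_sum (AddMonoidHom.mk' (mapBoundedNat (F := F) (F' := F')) mapBoundedNat_add) α s

end

/-- The identity functor induces the identity functor on derived categories. -/
def mapDerivedId : (𝟭 C).mapDerivedCategory ≅ 𝟭 (DerivedCategory C) :=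
  letI : Localization.Lifting DerivedCategory.Q
      (HomologicalComplex.quasiIso C (ComplexShape.up ℤ))
      ((𝟭 C).mapHomologicalComplex (ComplexShape.up ℤ) ⋙ DerivedCategory.Q)
      (𝟭 (DerivedCategory C)) :=
    ⟨Functor.rightUnitor _ ≪≫ (Functor.leftUnitor _).symm ≪≫
      Functor.isoWhiskerRight (Functor.mapHomologicalComplexIdIso C _).symm DerivedCategory.Q⟩
  Localization.liftNatIso DerivedCategory.Q (HomologicalComplex.quasiIso C (ComplexShape.up ℤ))
    ((𝟭 C).mapHomologicalComplex (ComplexShape.up ℤ) ⋙ DerivedCategory.Q)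
    ((𝟭 C).mapHomologicalComplex (ComplexShape.up ℤ) ⋙ DerivedCategory.Q) _ _ (Iso.refl _)

/-- The identity functor induces the identity functor on bounded derived categories. -/
def mapBoundedId : mapBounded (𝟭 C) ≅ 𝟭 (DerivedCategory.Bounded C) :=
  NatIso.ofComponents (fun X ↦ ObjectProperty.isoMk _ (mapDerivedId.app X.obj))
    (fun f ↦ ObjectProperty.hom_ext _ (mapDerivedId.hom.naturality f.hom))

section

variable {E : Type*} [Category* E] [Abelian E] [HasDerivedCategory E]
    {F : C ⥤ D} {F' : D ⥤ E} {F'' : C ⥤ E}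
    [F.Additive] [PreservesFiniteLimits F] [PreservesFiniteColimits F]
    [F'.Additive] [PreservesFiniteLimits F'] [PreservesFiniteColimits F']
    [F''.Additive] [PreservesFiniteLimits F''] [PreservesFiniteColimits F'']

lemma mapDerivedComp_hom_app (e : F ⋙ F' ≅ F'') (K : CochainComplex C ℤ) :
    (mapDerivedComp e).hom.app (DerivedCategory.Q.obj K) =
      F'.mapDerivedCategory.map (F.mapDerivedCategoryFactors.hom.app K) ≫
        F'.mapDerivedCategoryFactors.hom.app ((F.mapHomologicalComplex _).obj K) ≫
          DerivedCategory.Q.map ((NatTrans.mapHomologicalComplex e.hom _).app K) ≫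
            F''.mapDerivedCategoryFactors.inv.app K := by
  -- The lifting used inside `mapDerivedComp` is reproduced, so that the general formula for lifted
  -- transformations speaks of the same data.
  let _ : Localization.Lifting DerivedCategory.Q
      (HomologicalComplex.quasiIso C (ComplexShape.up ℤ))
      ((F ⋙ F').mapHomologicalComplex (ComplexShape.up ℤ) ⋙ DerivedCategory.Q)
      (F.mapDerivedCategory ⋙ F'.mapDerivedCategory) :=
    ⟨(Functor.associator _ _ _).symm ≪≫
      Functor.isoWhiskerRight F.mapDerivedCategoryFactors F'.mapDerivedCategory ≪≫
      Functor.associator _ _ _ ≪≫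
      Functor.isoWhiskerLeft (F.mapHomologicalComplex (ComplexShape.up ℤ))
        F'.mapDerivedCategoryFactors⟩
  have h := Localization.liftNatTrans_app DerivedCategory.Q
    (HomologicalComplex.quasiIso C (ComplexShape.up ℤ))
    ((F ⋙ F').mapHomologicalComplex (ComplexShape.up ℤ) ⋙ DerivedCategory.Q)
    (F''.mapHomologicalComplex (ComplexShape.up ℤ) ⋙ DerivedCategory.Q)
    (F.mapDerivedCategory ⋙ F'.mapDerivedCategory) F''.mapDerivedCategory
    (Functor.isoWhiskerRight (NatIso.mapHomologicalComplex e _) DerivedCategory.Q).hom K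
  refine h.trans ?_
  have h' : (Localization.Lifting.iso DerivedCategory.Q
      (HomologicalComplex.quasiIso C (ComplexShape.up ℤ))
      ((F ⋙ F').mapHomologicalComplex (ComplexShape.up ℤ) ⋙ DerivedCategory.Q)
      (F.mapDerivedCategory ⋙ F'.mapDerivedCategory)).hom.app K =
      F'.mapDerivedCategory.map (F.mapDerivedCategoryFactors.hom.app K) ≫
        F'.mapDerivedCategoryFactors.hom.app ((F.mapHomologicalComplex _).obj K) :=
    (Category.id_comp _).trans (congrArg _ (Category.id_comp _))
  rw [h']
  exact Category.assoc _ _ _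

end

section

variable {E E' : Type*} [Category* E] [Abelian E] [HasDerivedCategory E]
    [Category* E'] [Abelian E'] [HasDerivedCategory E']
    {F : C ⥤ D} {A : D ⥤ E} {B : E ⥤ E'} {FA : C ⥤ E} {AB : D ⥤ E'} {FAB : C ⥤ E'}
    [F.Additive] [PreservesFiniteLimits F] [PreservesFiniteColimits F]
    [A.Additive] [PreservesFiniteLimits A] [PreservesFiniteColimits A]
    [B.Additive] [PreservesFiniteLimits B] [PreservesFiniteColimits B]
    [FA.Additive] [PreservesFiniteLimits FA] [PreservesFiniteColimits FA]
    [AB.Additive] [PreservesFiniteLimits AB] [PreservesFiniteColimits AB]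
    [FAB.Additive] [PreservesFiniteLimits FAB] [PreservesFiniteColimits FAB]

/-- This is the cocycle condition of an invariant object in disguise: take twists for `A`, `B`,
`AB`, let `FA` and `FAB` be `F`, and let `eFA`, `e₁`, `e₂` be the invariance isomorphisms. The
hypothesis `h` only concerns modules. -/
lemma mapDerivedComp_assoc (eFA : F ⋙ A ≅ FA) (eAB : A ⋙ B ≅ AB) (e₁ : FA ⋙ B ≅ FAB)
    (e₂ : F ⋙ AB ≅ FAB)
    (h : ∀ M, eAB.hom.app (F.obj M) ≫ e₂.hom.app M = B.map (eFA.hom.app M) ≫ e₁.hom.app M)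
    (X : DerivedCategory C) :
    (mapDerivedComp eAB).hom.app (F.mapDerivedCategory.obj X) ≫ (mapDerivedComp e₂).hom.app X =
      B.mapDerivedCategory.map ((mapDerivedComp eFA).hom.app X) ≫
        (mapDerivedComp e₁).hom.app X := by
  let α : (F.mapDerivedCategory ⋙ A.mapDerivedCategory) ⋙ B.mapDerivedCategory ⟶
      FAB.mapDerivedCategory :=
    (Functor.associator _ _ _).hom ≫
      Functor.whiskerLeft F.mapDerivedCategory (mapDerivedComp eAB).hom ≫ (mapDerivedComp e₂).hom
  let β : (F.mapDerivedCategory ⋙ A.mapDerivedCategory) ⋙ B.mapDerivedCategory ⟶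
      FAB.mapDerivedCategory :=
    Functor.whiskerRight (mapDerivedComp eFA).hom B.mapDerivedCategory ≫ (mapDerivedComp e₁).hom
  have hα (X) : α.app X = (mapDerivedComp eAB).hom.app (F.mapDerivedCategory.obj X) ≫
      (mapDerivedComp e₂).hom.app X := Category.id_comp _
  have hβ (X) : β.app X = B.mapDerivedCategory.map ((mapDerivedComp eFA).hom.app X) ≫
        (mapDerivedComp e₁).hom.app X := rfl
  suffices α = β by rw [← hα, ← hβ, this]
  refine Localization.natTrans_ext DerivedCategory.Q
    (HomologicalComplex.quasiIso C (ComplexShape.up ℤ)) fun K ↦ ?_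
  rw [hα, hβ]
  -- The formula for `eAB` applies only at images of complexes under `Q`; naturality moves the
  -- argument there from `F.mapDerivedCategory.obj (Q.obj K)`.
  have hn := (mapDerivedComp eAB).hom.naturality (F.mapDerivedCategoryFactors.hom.app K)
  have hK : (NatTrans.mapHomologicalComplex eAB.hom (ComplexShape.up ℤ)).app
        ((F.mapHomologicalComplex _).obj K) ≫
        (NatTrans.mapHomologicalComplex e₂.hom (ComplexShape.up ℤ)).app K =
      (B.mapHomologicalComplex _).map
        ((NatTrans.mapHomologicalComplex eFA.hom (ComplexShape.up ℤ)).app K) ≫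
        (NatTrans.mapHomologicalComplex e₁.hom (ComplexShape.up ℤ)).app K := by
    ext i
    exact h (K.X i)
  rw [mapDerivedComp_hom_app e₂, mapDerivedComp_hom_app e₁, mapDerivedComp_hom_app eFA]
  rw [← reassoc_of% hn, mapDerivedComp_hom_app eAB]
  have hB := B.mapDerivedCategoryFactors.hom.naturality
    ((NatTrans.mapHomologicalComplex eFA.hom (ComplexShape.up ℤ)).app K)
  dsimp only [Functor.comp_map, Functor.comp_obj] at hB ⊢
  simp only [Functor.map_comp, Category.assoc, Iso.inv_hom_id_app_assoc]
  have hQ := (DerivedCategory.Q.map_comp _ _).symm.trans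
    ((congrArg DerivedCategory.Q.map hK).trans (DerivedCategory.Q.map_comp _ _))
  have hF : B.mapDerivedCategory.map (FA.mapDerivedCategoryFactors.inv.app K) ≫
      B.mapDerivedCategory.map (FA.mapDerivedCategoryFactors.hom.app K) = 𝟙 _ := by
    rw [← Functor.map_comp, Iso.inv_hom_id_app]
    exact CategoryTheory.Functor.map_id _ _
  rw [reassoc_of% hF]
  congr 2
  exact comp_eq_comp_of_squares hB hQ _

lemma mapBoundedComp_assoc (eFA : F ⋙ A ≅ FA) (eAB : A ⋙ B ≅ AB) (e₁ : FA ⋙ B ≅ FAB)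
    (e₂ : F ⋙ AB ≅ FAB)
    (h : ∀ M, eAB.hom.app (F.obj M) ≫ e₂.hom.app M = B.map (eFA.hom.app M) ≫ e₁.hom.app M)
    (X : DerivedCategory.Bounded C) :
    (mapBoundedComp eAB).hom.app ((mapBounded F).obj X) ≫ (mapBoundedComp e₂).hom.app X =
      (mapBounded B).map ((mapBoundedComp eFA).hom.app X) ≫ (mapBoundedComp e₁).hom.app X :=
  ObjectProperty.hom_ext _ (mapDerivedComp_assoc eFA eAB e₁ e₂ h X.obj)

end

section

variable (F : C ⥤ D) [F.Additive] [PreservesFiniteLimits F] [PreservesFiniteColimits F]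

instance : (mapBounded F).CommShift ℤ :=
  inferInstanceAs ((ObjectProperty.lift _ (DerivedCategory.Bounded.ι ⋙ F.mapDerivedCategory)
    (bounded_mapDerivedCategory F)).CommShift ℤ)

instance : (mapBounded F).IsTriangulated :=
  inferInstanceAs ((ObjectProperty.lift _ (DerivedCategory.Bounded.ι ⋙ F.mapDerivedCategory)
    (bounded_mapDerivedCategory F)).IsTriangulated)

end

end DerivedTransformations

/-! ### Twists of induced and restricted modules -/

section ModuleTransformations

variable {k : Type u} [Field k] {A B : Type u} [Ring A] [Algebra k A] [Ring B] [Algebra k B]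

/-- A morphism of right modules, given by an additive map that respects the action. -/
def RMod.homMk {M N : RMod k A} (f : FGModuleCat.carrier M →+ FGModuleCat.carrier N)
    (h : ∀ (r : Aᵐᵒᵖ) (m : FGModuleCat.carrier M), f (r • m) = r • f m) : M ⟶ N :=
  ObjectProperty.homMk (ModuleCat.ofHom { f with map_smul' := h })

lemma RMod.hom_ext {M N : RMod k A} {f g : M ⟶ N}
    (h : ∀ m : FGModuleCat.carrier M, f.hom.hom m = g.hom.hom m) : f = g :=
  FGModuleCat.hom_ext (LinearMap.ext h)

/-- Restriction along the identity is the identity functor. -/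
def resFunctorId [Module.Finite k A] (φ : A →ₐ[k] A) (hφ : φ = AlgHom.id k A) :
    resFunctor φ ≅ 𝟭 (RMod k A) where
  hom := { app M := RMod.homMk (AddMonoidHom.id _) (fun r m ↦ by subst hφ; rfl) }
  inv := { app M := RMod.homMk (AddMonoidHom.id _) (fun r m ↦ by subst hφ; rfl) }

/-- The additive automorphism `s ⊗ m ↦ σ s ⊗ m` of `M ⊗_A B`, for `σ` trivial on the image of
`A`. -/
def indConj (φ : A →ₐ[k] B) (σ : B →ₐ[k] B) (hσ : ∀ a, σ (φ a) = φ a) (M : RMod k A) :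
    ExtScalars.Obj (opHom φ) (FGModuleCat.carrier M) →+
      ExtScalars.Obj (opHom φ) (FGModuleCat.carrier M) :=
  ExtScalars.lift (opHom φ)
    (AddMonoidHom.mk' (fun s ↦ AddMonoidHom.mk' (ExtScalars.tmul (opHom φ) (opHom σ s))
        (ExtScalars.tmul_add (opHom φ) (opHom σ s)))
      (fun s t ↦ AddMonoidHom.ext fun m ↦ by
        change ExtScalars.tmul _ (opHom σ (s + t)) m = _
        rw [map_add]
        exact ExtScalars.add_tmul _ _ _ _))
    (fun s r m ↦ by
      change ExtScalars.tmul _ (opHom σ (s * opHom φ r)) m = ExtScalars.tmul _ (opHom σ s) (r • m)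
      have h : opHom σ (opHom φ r) = opHom φ r := congrArg MulOpposite.op (hσ r.unop)
      rw [map_mul, h, ExtScalars.mul_tmul])

lemma indConj_tmul (φ : A →ₐ[k] B) (σ : B →ₐ[k] B) (hσ : ∀ a, σ (φ a) = φ a) (M : RMod k A)
    (s : Bᵐᵒᵖ) (m : FGModuleCat.carrier M) :
    indConj φ σ hσ M (ExtScalars.tmul (opHom φ) s m) =
      ExtScalars.tmul (opHom φ) (opHom σ s) m := rfl

lemma indConj_smul (φ : A →ₐ[k] B) (σ : B →ₐ[k] B) (hσ : ∀ a, σ (φ a) = φ a) (M : RMod k A)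
    (s : Bᵐᵒᵖ) (z : ExtScalars.Obj (opHom φ) (FGModuleCat.carrier M)) :
    indConj φ σ hσ M (s • z) = opHom σ s • indConj φ σ hσ M z := by
  have : (indConj φ σ hσ M).comp (DistribSMul.toAddMonoidHom _ s) =
      (DistribSMul.toAddMonoidHom _ (opHom σ s)).comp (indConj φ σ hσ M) := by
    refine ExtScalars.addHom_ext _ fun t m ↦ ?_
    change indConj φ σ hσ M (s • ExtScalars.tmul _ t m) =
      opHom σ s • indConj φ σ hσ M (ExtScalars.tmul _ t m)
    rw [ExtScalars.smul_tmul', indConj_tmul, indConj_tmul, ExtScalars.smul_tmul', map_mul]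
  exact DFunLike.congr_fun this z

lemma indConj_indConj (φ : A →ₐ[k] B) (σ τ : B →ₐ[k] B) (hσ : ∀ a, σ (φ a) = φ a)
    (hτ : ∀ a, τ (φ a) = φ a) (υ : B →ₐ[k] B) (h : υ = σ.comp τ) (hυ : ∀ a, υ (φ a) = φ a)
    (M : RMod k A) (z : ExtScalars.Obj (opHom φ) (FGModuleCat.carrier M)) :
    indConj φ σ hσ M (indConj φ τ hτ M z) = indConj φ υ hυ M z := by
  subst h
  have : (indConj φ σ hσ M).comp (indConj φ τ hτ M) = indConj φ (σ.comp τ) hυ M :=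
    ExtScalars.addHom_ext _ fun t m ↦ rfl
  exact DFunLike.congr_fun this z

lemma indConj_id (φ : A →ₐ[k] B) (σ : B →ₐ[k] B) (h : σ = AlgHom.id k B)
    (hσ : ∀ a, σ (φ a) = φ a)
    (M : RMod k A) (z : ExtScalars.Obj (opHom φ) (FGModuleCat.carrier M)) :
    indConj φ σ hσ M z = z := by
  subst h
  have : indConj φ (AlgHom.id k B) hσ M = AddMonoidHom.id _ :=
    ExtScalars.addHom_ext _ fun t m ↦ rfl
  exact DFunLike.congr_fun this z

/-- Induced modules are invariant under automorphisms `σ` of `B` that are trivial on the image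
of `A`: the isomorphism is `s ⊗ m ↦ σ⁻¹ s ⊗ m`. -/
def indTwist [Module.Finite k B] (φ : A →ₐ[k] B) (σ : B ≃ₐ[k] B) (hσ : ∀ a, σ (φ a) = φ a) :
    indFunctor φ ⋙ resFunctor (σ : B →ₐ[k] B) ≅ indFunctor φ where
  hom :=
    { app M := RMod.homMk (indConj φ (σ.symm : B →ₐ[k] B)
          (fun a ↦ σ.symm_apply_eq.2 (hσ a).symm) M)
        (fun r z ↦ (indConj_smul _ _ _ M (opHom (σ : B →ₐ[k] B) r) z).trans
          (congrArg (· • _) (congrArg MulOpposite.op (σ.symm_apply_apply r.unop))))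
      naturality M N f := RMod.hom_ext fun z ↦ DFunLike.congr_fun (f := AddMonoidHom.comp
        (indConj φ (σ.symm : B →ₐ[k] B) (fun a ↦ σ.symm_apply_eq.2 (hσ a).symm) N)
        (ExtScalars.map (opHom φ) (M := FGModuleCat.carrier M) (N := FGModuleCat.carrier N)
          f.hom.hom).toAddMonoidHom)
        (g := AddMonoidHom.comp (ExtScalars.map (opHom φ) (M := FGModuleCat.carrier M)
          (N := FGModuleCat.carrier N) f.hom.hom).toAddMonoidHom
          (indConj φ (σ.symm : B →ₐ[k] B) (fun a ↦ σ.symm_apply_eq.2 (hσ a).symm) M))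
        (ExtScalars.addHom_ext _ fun _ _ ↦ rfl) z }
  inv :=
    { app M := RMod.homMk (indConj φ (σ : B →ₐ[k] B) hσ M)
        (fun r z ↦ indConj_smul _ _ _ M r z)
      naturality M N f := RMod.hom_ext fun z ↦ DFunLike.congr_fun (f := AddMonoidHom.comp
        (indConj φ (σ : B →ₐ[k] B) hσ N)
        (ExtScalars.map (opHom φ) (M := FGModuleCat.carrier M) (N := FGModuleCat.carrier N)
          f.hom.hom).toAddMonoidHom)
        (g := AddMonoidHom.comp (ExtScalars.map (opHom φ) (M := FGModuleCat.carrier M)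
          (N := FGModuleCat.carrier N) f.hom.hom).toAddMonoidHom
          (indConj φ (σ : B →ₐ[k] B) hσ M))
        (ExtScalars.addHom_ext _ fun _ _ ↦ rfl) z }
  hom_inv_id := by
    ext M : 2
    exact RMod.hom_ext fun z ↦ (indConj_indConj φ (σ : B →ₐ[k] B) (σ.symm : B →ₐ[k] B)
      hσ (fun a ↦ σ.symm_apply_eq.2 (hσ a).symm) (AlgHom.id k B)
      (AlgHom.ext fun b ↦ (σ.apply_symm_apply b).symm) (fun _ ↦ rfl) M z).trans (indConj_id φ _ rfl _ M z)
  inv_hom_id := by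
    ext M : 2
    exact RMod.hom_ext fun z ↦ (indConj_indConj φ (σ.symm : B →ₐ[k] B) (σ : B →ₐ[k] B)
      (fun a ↦ σ.symm_apply_eq.2 (hσ a).symm) hσ (AlgHom.id k B)
      (AlgHom.ext fun b ↦ (σ.symm_apply_apply b).symm) (fun _ ↦ rfl) M z).trans (indConj_id φ _ rfl _ M z)

/-- Both sides act on the factor `B` by `υ⁻¹ = τ⁻¹ σ⁻¹`. This is the module-level cocycle identity
for induced objects. -/
lemma indTwist_comp [Module.Finite k B] (φ : A →ₐ[k] B) (σ τ υ : B ≃ₐ[k] B) (h : υ = σ * τ)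
    (hσ : ∀ a, σ (φ a) = φ a) (hτ : ∀ a, τ (φ a) = φ a) (hυ : ∀ a, υ (φ a) = φ a)
    (hc : (υ : B →ₐ[k] B) = (σ : B →ₐ[k] B).comp (τ : B →ₐ[k] B)) (M : RMod k A) :
    (resFunctorComp (τ : B →ₐ[k] B) (σ : B →ₐ[k] B) (υ : B →ₐ[k] B) hc).hom.app
        ((indFunctor φ).obj M) ≫ (indTwist φ υ hυ).hom.app M =
      (resFunctor (τ : B →ₐ[k] B)).map ((indTwist φ σ hσ).hom.app M) ≫
        (indTwist φ τ hτ).hom.app M :=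
  RMod.hom_ext fun z ↦ (indConj_indConj φ (τ.symm : B →ₐ[k] B) (σ.symm : B →ₐ[k] B)
    (fun a ↦ τ.symm_apply_eq.2 (hτ a).symm) (fun a ↦ σ.symm_apply_eq.2 (hσ a).symm)
    (υ.symm : B →ₐ[k] B) (by subst h; rfl) (fun a ↦ υ.symm_apply_eq.2 (hυ a).symm) M z).symm

/-- Restricted modules are invariant under automorphisms `σ` of `A` that become inner in `B`:
the isomorphism is the right action of a unit `u`. -/
def resTwist [Module.Finite k A] [Module.Finite k B] (φ : A →ₐ[k] B) (σ : A ≃ₐ[k] A) (u : Bˣ)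
    (hu : ∀ a, φ (σ a) * u = u * φ a) :
    resFunctor φ ⋙ resFunctor (σ : A →ₐ[k] A) ≅ resFunctor φ where
  hom :=
    { app N := RMod.homMk
        (DistribSMul.toAddMonoidHom (FGModuleCat.carrier N) (MulOpposite.op (u : B)))
        (fun r n ↦ (smul_smul (MulOpposite.op (u : B)) (opHom φ (opHom (σ : A →ₐ[k] A) r))
            (show FGModuleCat.carrier N from n)).trans
          ((congrArg (· • _) (congrArg MulOpposite.op (hu r.unop))).trans
            (smul_smul (opHom φ r) (MulOpposite.op (u : B))
              (show FGModuleCat.carrier N from n)).symm))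
      naturality N P f := RMod.hom_ext fun n ↦ (f.hom.hom.map_smul (MulOpposite.op (u : B)) n).symm }
  inv :=
    { app N := RMod.homMk
        (DistribSMul.toAddMonoidHom (FGModuleCat.carrier N) (MulOpposite.op ((u⁻¹ : Bˣ) : B)))
        (fun r n ↦ (smul_smul (MulOpposite.op ((u⁻¹ : Bˣ) : B)) (opHom φ r)
            (show FGModuleCat.carrier N from n)).trans
          ((congrArg (· • _) (congrArg MulOpposite.op
            ((u.eq_inv_mul_iff_mul_eq).2 (by
              rw [← mul_assoc]; exact (Units.mul_inv_eq_iff_eq_mul u).2 (hu r.unop).symm)))).trans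
            (smul_smul (opHom φ (opHom (σ : A →ₐ[k] A) r)) (MulOpposite.op ((u⁻¹ : Bˣ) : B))
              (show FGModuleCat.carrier N from n)).symm))
      naturality N P f := RMod.hom_ext fun n ↦
        (f.hom.hom.map_smul (MulOpposite.op ((u⁻¹ : Bˣ) : B)) n).symm }
  hom_inv_id := by
    ext N : 2
    refine RMod.hom_ext fun n ↦ (smul_smul (MulOpposite.op ((u⁻¹ : Bˣ) : B))
      (MulOpposite.op (u : B)) (show FGModuleCat.carrier N from n)).trans ?_
    rw [← MulOpposite.op_mul, Units.mul_inv]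
    exact one_smul _ _
  inv_hom_id := by
    ext N : 2
    refine RMod.hom_ext fun n ↦ (smul_smul (MulOpposite.op (u : B))
      (MulOpposite.op ((u⁻¹ : Bˣ) : B)) (show FGModuleCat.carrier N from n)).trans ?_
    rw [← MulOpposite.op_mul, Units.inv_mul]
    exact one_smul _ _

/-- Right multiplication by `u` and then by `v` is right multiplication by `u * v`. This is the
module-level cocycle identity for restricted objects. -/
lemma resTwist_comp [Module.Finite k A] [Module.Finite k B] (φ : A →ₐ[k] B) (σ τ υ : A ≃ₐ[k] A)
    (u v t : Bˣ) (h : t = u * v)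
    (hu : ∀ a, φ (σ a) * u = u * φ a) (hv : ∀ a, φ (τ a) * v = v * φ a)
    (ht : ∀ a, φ (υ a) * t = t * φ a)
    (hc : (υ : A →ₐ[k] A) = (σ : A →ₐ[k] A).comp (τ : A →ₐ[k] A)) (N : RMod k B) :
    (resFunctorComp (τ : A →ₐ[k] A) (σ : A →ₐ[k] A) (υ : A →ₐ[k] A) hc).hom.app
        ((resFunctor φ).obj N) ≫ (resTwist φ υ t ht).hom.app N =
      (resFunctor (τ : A →ₐ[k] A)).map ((resTwist φ σ u hu).hom.app N) ≫
        (resTwist φ τ v hv).hom.app N :=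
  RMod.hom_ext fun n ↦ by
    subst h
    exact (smul_smul (MulOpposite.op (v : B)) (MulOpposite.op (u : B))
      (show FGModuleCat.carrier N from n)).symm

end ModuleTransformations

/-- Summing over `j` first leaves the coefficient `∑ j, x j i` at `m i`. In the application `j` runs
over characters and `i` over group elements, and the hypotheses are character orthogonality. -/
lemma ExtScalars.sum_sum_tmul {R S : Type u} [Ring R] [Ring S] (f : R →+* S) {M : Type u}
    [AddCommGroup M] [Module R M] {ι κ : Type*} [Fintype ι] [Fintype κ] (x : κ → ι → S)
    (m : ι → M) (i₀ : ι) (hx : ∑ j, x j i₀ = 1) (hx' : ∀ i, i ≠ i₀ → ∑ j, x j i = 0) :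
    ∑ j, ∑ i, tmul f (x j i) (m i) = tmul f 1 (m i₀) := by
  let T (m : M) : S →+ Obj f M :=
    AddMonoidHom.mk' (fun s ↦ tmul f s m) (fun s t ↦ add_tmul _ s t m)
  have h (i : ι) : ∑ j, tmul f (x j i) (m i) = T (m i) (∑ j, x j i) := (map_sum (T _) _ _).symm
  rw [Finset.sum_comm, Finset.sum_congr rfl fun i _ ↦ h i,
    Finset.sum_eq_single i₀ (fun i _ hi ↦ by rw [hx' i hi, map_zero]) (by simp), hx]
  rfl

/-! ### Splitting the two composites of induction and restriction -/

section Splittings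

variable {k : Type u} [Field k] {A B : Type u} [Ring A] [Algebra k A] [Ring B] [Algebra k B]
  [Module.Finite k A] [Module.Finite k B]

omit [Module.Finite k A] in
lemma RMod.map_smul {M N : RMod k A} (f : M ⟶ N) (r : Aᵐᵒᵖ) (m : FGModuleCat.carrier M) :
    f.hom.hom (r • m) = r • f.hom.hom m :=
  f.hom.hom.map_smul r m

lemma RMod.sum_apply {ι : Type*} (s : Finset ι) {M N : RMod k A} (f : ι → (M ⟶ N))
    (m : FGModuleCat.carrier M) : (∑ i ∈ s, f i).hom.hom m = ∑ i ∈ s, (f i).hom.hom m :=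
  map_sum (AddMonoidHom.mk' (fun f : M ⟶ N ↦ f.hom.hom m) (fun _ _ ↦ rfl)) f s

omit [Module.Finite k A] [Module.Finite k B] in
lemma indFunctor_hom_ext {φ : A →ₐ[k] B} {M : RMod k A} {X : RMod k B}
    {f g : (indFunctor φ).obj M ⟶ X}
    (h : ∀ m : FGModuleCat.carrier M, f.hom.hom (ExtScalars.tmul (opHom φ) 1 m) =
      g.hom.hom (ExtScalars.tmul (opHom φ) 1 m)) : f = g := by
  refine FGModuleCat.hom_ext (ExtScalars.linearMap_ext (opHom φ)
    (M := FGModuleCat.carrier M) fun s m ↦ ?_)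
  have hs : ExtScalars.tmul (opHom φ) s m = s • ExtScalars.tmul (opHom φ) 1 m := by
    rw [ExtScalars.smul_tmul', mul_one]
  refine (congrArg _ hs).trans ((RMod.map_smul f _ _).trans (Eq.symm ?_))
  exact (congrArg _ hs).trans ((RMod.map_smul g _ _).trans (congrArg _ (h m).symm))

section

variable {φ : A →ₐ[k] B} {ι : Type u} [Fintype ι] [DecidableEq ι]
  (b : ExtScalars.RightBasis (opHom φ) ι)

/-- The projection of `Res (M ⊗_A B)` to a twist of `M` given by the coordinate at `i`. -/
def coordNat (i : ι) (σ : A →ₐ[k] A)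
    (h : ∀ a s, b.c i (opHom φ a * s) = opHom σ a * b.c i s) :
    indFunctor φ ⋙ resFunctor φ ⟶ resFunctor σ where
  app M := RMod.homMk (b.coord (FGModuleCat.carrier M) i) (fun r z ↦ by
    have : (b.coord (FGModuleCat.carrier M) i).comp (DistribSMul.toAddMonoidHom _ (opHom φ r)) =
        (DistribSMul.toAddMonoidHom _ (opHom σ r)).comp (b.coord (FGModuleCat.carrier M) i) := by
      refine ExtScalars.addHom_ext _ fun t m ↦ ?_
      change b.c i (opHom φ r * t) • m = opHom σ r • b.c i t • m
      rw [h, mul_smul]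
    exact DFunLike.congr_fun this z)
  naturality M N f := RMod.hom_ext fun z ↦ b.coord_map (M := FGModuleCat.carrier M)
    (N := FGModuleCat.carrier N) f.hom.hom i z

/-- The additive map `m ↦ b ⊗ m`. -/
def tmulHom (φ : A →ₐ[k] B) (s : Bᵐᵒᵖ) (M : RMod k A) :
    FGModuleCat.carrier M →+ ExtScalars.Obj (opHom φ) (FGModuleCat.carrier M) :=
  AddMonoidHom.mk' (ExtScalars.tmul (opHom φ) s) (ExtScalars.tmul_add (opHom φ) s)

/-- The inclusion of a twist of `M` into `Res (M ⊗_A B)` given by the basis vector `b i`. -/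
def basisNat (i : ι) (σ : A →ₐ[k] A) (h : ∀ a, opHom φ a * b.b i = b.b i * opHom φ (opHom σ a)) :
    resFunctor σ ⟶ indFunctor φ ⋙ resFunctor φ where
  app M := RMod.homMk (tmulHom φ (b.b i) M)
    (fun r m ↦ (ExtScalars.mul_tmul (opHom φ) (M := FGModuleCat.carrier M) (b.b i)
      (opHom σ r) m).symm.trans (congrArg (fun s ↦ ExtScalars.tmul (opHom φ)
        (M := FGModuleCat.carrier M) s m) (h r).symm))
  naturality _ _ _ := RMod.hom_ext fun _ ↦ rfl

/-- Every tensor is `∑ b i ⊗ c i z`; the hypotheses say that moving `A` past `b i` costs the twist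
`σ i`. Only this half of a direct sum decomposition is needed to land in the additive closure of the
twists. -/
lemma sum_coordNat_basisNat (σ : ι → (A →ₐ[k] A))
    (h : ∀ i a s, b.c i (opHom φ a * s) = opHom (σ i) a * b.c i s)
    (h' : ∀ i a, opHom φ a * b.b i = b.b i * opHom φ (opHom (σ i) a)) :
    ∑ i, coordNat b i (σ i) (h i) ≫ basisNat b i (σ i) (h' i) = 𝟙 _ := by
  ext M : 2
  refine RMod.hom_ext fun z ↦ ?_
  rw [NatTrans.app_sum]
  exact (RMod.sum_apply _ _ z).trans (b.sum_coord (M := FGModuleCat.carrier M) z)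

/-- Used at the index `1 ∈ G`, whose twist is trivial, to split off `M` itself. -/
lemma basisNat_coordNat (i : ι) (σ : A →ₐ[k] A)
    (h : ∀ a s, b.c i (opHom φ a * s) = opHom σ a * b.c i s)
    (h' : ∀ a, opHom φ a * b.b i = b.b i * opHom φ (opHom σ a)) :
    basisNat b i σ h' ≫ coordNat b i σ h = 𝟙 _ := by
  ext M : 2
  refine RMod.hom_ext fun z ↦ ?_
  exact (congrArg (fun r : Aᵐᵒᵖ ↦ r • (show FGModuleCat.carrier M from z))
    ((b.c_b i i).trans (if_pos rfl))).trans (one_smul _ _)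

end

section

variable (φ : A →ₐ[k] B)

/-- The twisted action map `s ⊗ n ↦ σ s • n`. -/
def actHom (σ : B →ₐ[k] B) (hσ : ∀ a, σ (φ a) = φ a) (N : RMod k B) :
    ExtScalars.Obj (opHom φ) (FGModuleCat.carrier ((resFunctor φ).obj N)) →+
      FGModuleCat.carrier N :=
  ExtScalars.lift (opHom φ)
    ((smulAddHom Bᵐᵒᵖ (FGModuleCat.carrier N)).comp (opHom σ).toAddMonoidHom)
    (fun s r m ↦ by
      change opHom σ (s * opHom φ r) • (show FGModuleCat.carrier N from m) =
        opHom σ s • opHom φ r • (show FGModuleCat.carrier N from m)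
      have h : opHom σ (opHom φ r) = opHom φ r := congrArg MulOpposite.op (hσ r.unop)
      rw [map_mul, h, mul_smul])

/-- The natural transformation from `(Res N) ⊗_A B` to a twist of `N`. -/
def actNat (σ : B →ₐ[k] B) (hσ : ∀ a, σ (φ a) = φ a) :
    resFunctor φ ⋙ indFunctor φ ⟶ resFunctor σ where
  app N := RMod.homMk (actHom φ σ hσ N) (fun r z ↦ by
    have : (actHom φ σ hσ N).comp (DistribSMul.toAddMonoidHom _ r) =
        (DistribSMul.toAddMonoidHom _ (opHom σ r)).comp (actHom φ σ hσ N) := by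
      refine ExtScalars.addHom_ext _ fun t m ↦ ?_
      change opHom σ (r * t) • (show FGModuleCat.carrier N from m) =
        opHom σ r • opHom σ t • (show FGModuleCat.carrier N from m)
      rw [map_mul, mul_smul]
    exact DFunLike.congr_fun this z)
  naturality N P f := RMod.hom_ext fun z ↦ DFunLike.congr_fun
    (f := (actHom φ σ hσ P).comp (ExtScalars.map (opHom φ)
      (M := FGModuleCat.carrier ((resFunctor φ).obj N))
      (N := FGModuleCat.carrier ((resFunctor φ).obj P))
      ((resFunctor φ).map f).hom.hom).toAddMonoidHom)
    (g := AddMonoidHom.comp f.hom.hom.toAddMonoidHom (actHom φ σ hσ N))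
    (ExtScalars.addHom_ext _ fun s n ↦ (f.hom.hom.map_smul (opHom σ s) n).symm) z

/-- The additive map `n ↦ ∑ i, x i ⊗ y i • n`. -/
def casimirHom {ι : Type*} [Fintype ι] (x y : ι → Bᵐᵒᵖ) (N : RMod k B) :
    FGModuleCat.carrier N →+
      ExtScalars.Obj (opHom φ) (FGModuleCat.carrier ((resFunctor φ).obj N)) :=
  ∑ i, (AddMonoidHom.mk' (ExtScalars.tmul (opHom φ) (x i))
    (ExtScalars.tmul_add (opHom φ) (x i))).comp
      (DistribSMul.toAddMonoidHom (FGModuleCat.carrier N) (y i))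

omit [Module.Finite k A] in
lemma casimirHom_apply {ι : Type*} [Fintype ι] (x y : ι → Bᵐᵒᵖ) (N : RMod k B)
    (n : FGModuleCat.carrier N) : casimirHom φ x y N n =
      ∑ i, ExtScalars.tmul (opHom φ) (M := FGModuleCat.carrier ((resFunctor φ).obj N))
        (x i) (y i • n) :=
  AddMonoidHom.finsetSum_apply _ _ _

/-- The natural transformation `n ↦ ∑ i, x i ⊗ y i • n` from a twist of `N` to
`(Res N) ⊗_A B`. -/
def casimirNat {ι : Type*} [Fintype ι] (x y : ι → Bᵐᵒᵖ) (σ : B →ₐ[k] B)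
    (h : ∀ (N : RMod k B) (r : Bᵐᵒᵖ) (n : FGModuleCat.carrier N),
      casimirHom φ x y N (opHom σ r • n) = r • casimirHom φ x y N n) :
    resFunctor σ ⟶ resFunctor φ ⋙ indFunctor φ where
  app N := RMod.homMk (casimirHom φ x y N) (h N)
  naturality N P f := RMod.hom_ext fun n ↦ by
    change casimirHom φ x y P (f.hom.hom n) = ExtScalars.map (opHom φ)
      (M := FGModuleCat.carrier ((resFunctor φ).obj N))
      (N := FGModuleCat.carrier ((resFunctor φ).obj P))
      ((resFunctor φ).map f).hom.hom (casimirHom φ x y N n)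
    refine (casimirHom_apply φ x y P (f.hom.hom n)).trans (Eq.symm ?_)
    refine (congrArg _ (casimirHom_apply φ x y N n)).trans ((map_sum _ _ _).trans ?_)
    exact Finset.sum_congr rfl fun i _ ↦ congrArg (ExtScalars.tmul (opHom φ)
      (M := FGModuleCat.carrier ((resFunctor φ).obj P)) (x i)) (RMod.map_smul f (y i) n)

omit [Module.Finite k A] in
-- The composite acts by the element `∑ i, σ (x i) * y i`, so `hxy` is a twisted form of the
-- separability condition.
lemma casimirNat_actNat {ι : Type*} [Fintype ι] (x y : ι → Bᵐᵒᵖ) (σ : B →ₐ[k] B)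
    (hσ : ∀ a, σ (φ a) = φ a)
    (h : ∀ (N : RMod k B) (r : Bᵐᵒᵖ) (n : FGModuleCat.carrier N),
      casimirHom φ x y N (opHom σ r • n) = r • casimirHom φ x y N n)
    (hxy : ∑ i, opHom σ (x i) * y i = 1) :
    casimirNat φ x y σ h ≫ actNat φ σ hσ = 𝟙 _ := by
  ext N : 2
  refine RMod.hom_ext fun n ↦ ?_
  change actHom φ σ hσ N (casimirHom φ x y N n) = n
  refine (congrArg _ (casimirHom_apply φ x y N n)).trans ((map_sum _ _ _).trans ?_)
  change ∑ i, opHom σ (x i) • y i • (show FGModuleCat.carrier N from n) = n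
  refine (Finset.sum_congr rfl fun i _ ↦ smul_smul _ _ _).trans ?_
  exact Finset.sum_smul.symm.trans ((congrArg (· • _) hxy).trans (one_smul _ _))

omit [Module.Finite k A] in
lemma actNat_casimirNat_tmul {ι : Type*} [Fintype ι] (x y : ι → Bᵐᵒᵖ) (σ : B →ₐ[k] B)
    (hσ : ∀ a, σ (φ a) = φ a)
    (h : ∀ (N : RMod k B) (r : Bᵐᵒᵖ) (n : FGModuleCat.carrier N),
      casimirHom φ x y N (opHom σ r • n) = r • casimirHom φ x y N n)
    (N : RMod k B) (n : FGModuleCat.carrier N) :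
    ((actNat φ σ hσ ≫ casimirNat φ x y σ h).app N).hom.hom
      (ExtScalars.tmul (opHom φ) (M := FGModuleCat.carrier ((resFunctor φ).obj N)) 1 n) =
      ∑ i, ExtScalars.tmul (opHom φ) (M := FGModuleCat.carrier ((resFunctor φ).obj N))
        (x i) (y i • n) := by
  refine Eq.trans ?_ (casimirHom_apply φ x y N n)
  change casimirHom φ x y N (opHom σ 1 • n) = _
  rw [map_one, one_smul]

omit [Module.Finite k A] in
-- It is enough to test on `1 ⊗ n`, which generate; there the sum over `j` kills all terms except
-- the one at `i₀`, by `ExtScalars.sum_sum_tmul`.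
lemma sum_actNat_casimirNat {ι κ : Type*} [Fintype ι] [Fintype κ] (x : κ → ι → Bᵐᵒᵖ)
    (y : ι → Bᵐᵒᵖ) (σ : κ → (B →ₐ[k] B)) (hσ : ∀ j a, σ j (φ a) = φ a)
    (h : ∀ (j : κ) (N : RMod k B) (r : Bᵐᵒᵖ) (n : FGModuleCat.carrier N),
      casimirHom φ (x j) y N (opHom (σ j) r • n) = r • casimirHom φ (x j) y N n)
    (i₀ : ι) (hy : y i₀ = 1) (hx : ∑ j, x j i₀ = 1) (hx' : ∀ i, i ≠ i₀ → ∑ j, x j i = 0) :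
    ∑ j, actNat φ (σ j) (hσ j) ≫ casimirNat φ (x j) y (σ j) (h j) = 𝟙 _ := by
  ext N : 2
  rw [NatTrans.app_sum]
  refine indFunctor_hom_ext (φ := φ) (M := (resFunctor φ).obj N)
    (X := (resFunctor φ ⋙ indFunctor φ).obj N) fun n ↦ ?_
  refine (RMod.sum_apply Finset.univ
    (fun j ↦ (actNat φ (σ j) (hσ j) ≫ casimirNat φ (x j) y (σ j) (h j)).app N) _).trans ?_
  refine (Finset.sum_congr rfl fun j _ ↦
    actNat_casimirNat_tmul φ (x j) y (σ j) (hσ j) (h j) N n).trans ?_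
  refine (ExtScalars.sum_sum_tmul (opHom φ) (M := FGModuleCat.carrier ((resFunctor φ).obj N)) x
    (fun i ↦ y i • (show FGModuleCat.carrier N from n)) i₀ hx hx').trans ?_
  exact congrArg (ExtScalars.tmul (opHom φ) (M := FGModuleCat.carrier ((resFunctor φ).obj N)) 1)
    ((congrArg (· • (show FGModuleCat.carrier N from n)) hy).trans
      (one_smul Bᵐᵒᵖ (show FGModuleCat.carrier N from n)))

end

end Splittings

/-! ### Additive closures and transfer of tilting objects -/

section AddClosure

open Pretriangulated

variable {C : Type u₁} [Category.{v₁} C] [Preadditive C] [HasZeroObject C] [HasShift C ℤ]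
  [∀ n : ℤ, (shiftFunctor C n).Additive] [Pretriangulated C]
  {D : Type u₂} [Category.{v₂} D] [Preadditive D] [HasZeroObject D] [HasShift D ℤ]
  [∀ n : ℤ, (shiftFunctor D n).Additive] [Pretriangulated D]

/-- With its converse `addClosure.exists_sum`, this replaces summands of biproducts by equations `∑
a i ≫ b i = 𝟙`, which additive functors visibly preserve and which any finite index type can carry.
-/
lemma addClosure_of_sum {ι : Type*} [Fintype ι] {T X : C} (a : ι → (X ⟶ T)) (b : ι → (T ⟶ X))
    (h : ∑ i, a i ≫ b i = 𝟙 X) : addClosure T X := by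
  let e := Fintype.equivFin ι
  refine ⟨Fintype.card ι, ⟨⟨biproduct.lift fun i ↦ a (e.symm i),
    biproduct.desc fun i ↦ b (e.symm i), ?_⟩⟩⟩
  rw [biproduct.lift_desc, ← h]
  exact e.symm.sum_comp fun i ↦ a i ≫ b i

lemma addClosure.exists_sum {T X : C} (h : addClosure T X) :
    ∃ (n : ℕ) (a : Fin n → (X ⟶ T)) (b : Fin n → (T ⟶ X)), ∑ i, a i ≫ b i = 𝟙 X := by
  obtain ⟨n, ⟨r⟩⟩ := h
  refine ⟨n, fun i ↦ r.i ≫ biproduct.π (fun _ : Fin n ↦ T) i,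
    fun i ↦ biproduct.ι (fun _ : Fin n ↦ T) i ≫ r.r, ?_⟩
  have : ∑ i, (r.i ≫ biproduct.π (fun _ : Fin n ↦ T) i) ≫
      biproduct.ι (fun _ : Fin n ↦ T) i ≫ r.r =
      r.i ≫ (∑ i, biproduct.π (fun _ : Fin n ↦ T) i ≫ biproduct.ι (fun _ : Fin n ↦ T) i) ≫ r.r := by
    simp only [Preadditive.comp_sum, Preadditive.sum_comp, Category.assoc]
  rw [this, biproduct.total, Category.id_comp, r.retract]

lemma addClosure_of_retract {T X : C} (r : Retract X T) : addClosure T X :=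
  addClosure_of_sum (ι := Unit) (fun _ ↦ r.i) (fun _ ↦ r.r) (by simp)

lemma addClosure_self (T : C) : addClosure T T := addClosure_of_retract (Retract.refl T)

lemma addClosure.trans {T X Y : C} (hX : addClosure Y X) (hY : addClosure T Y) :
    addClosure T X := by
  obtain ⟨n, a, b, h⟩ := hX.exists_sum
  obtain ⟨m, c, d, h'⟩ := hY.exists_sum
  refine addClosure_of_sum (ι := Fin n × Fin m) (fun p ↦ a p.1 ≫ c p.2)
    (fun p ↦ d p.2 ≫ b p.1) ?_
  rw [Fintype.sum_prod_type, ← h]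
  refine Finset.sum_congr rfl fun i _ ↦ ?_
  have : ∑ j, (a i ≫ c j) ≫ d j ≫ b i = a i ≫ (∑ j, c j ≫ d j) ≫ b i := by
    simp only [Preadditive.comp_sum, Preadditive.sum_comp, Category.assoc]
  rw [this, h', Category.id_comp]

lemma addClosure_le {T T' : C} (h : addClosure T T') : addClosure T' ≤ addClosure T :=
  fun _ hX ↦ addClosure.trans hX h

lemma addClosure_eq {T T' : C} (h : addClosure T T') (h' : addClosure T' T) :
    addClosure T = addClosure T' :=
  le_antisymm (addClosure_le h') (addClosure_le h)

lemma addClosure.map (F : C ⥤ D) [F.Additive] {T X : C} (h : addClosure T X) :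
    addClosure (F.obj T) (F.obj X) := by
  obtain ⟨n, a, b, h⟩ := h.exists_sum
  refine addClosure_of_sum (fun i ↦ F.map (a i)) (fun i ↦ F.map (b i)) ?_
  rw [← F.map_id, ← h, F.map_sum]
  simp only [F.map_comp]

lemma addClosure_map_eq (F : C ⥤ D) [F.Additive] {T T' : C} (h : addClosure T = addClosure T') :
    addClosure (F.obj T) = addClosure (F.obj T') :=
  addClosure_eq (addClosure.map F (h ▸ addClosure_self T'))
    (addClosure.map F (h.symm ▸ addClosure_self T))

/-- Inserting the decompositions of both identities writes `f` as a sum of maps that factor through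
maps `T ⟶ S`. -/
lemma addClosure.hom_eq_zero {T S X Y : C} (hTS : ∀ f : T ⟶ S, f = 0) (hX : addClosure T X)
    (hY : addClosure S Y) (f : X ⟶ Y) : f = 0 := by
  obtain ⟨n, a, b, h⟩ := hX.exists_sum
  obtain ⟨m, c, d, h'⟩ := hY.exists_sum
  rw [← Category.id_comp f, ← Category.comp_id f, ← h, ← h', Preadditive.sum_comp]
  refine Finset.sum_eq_zero fun i _ ↦ ?_
  rw [Preadditive.comp_sum, Preadditive.comp_sum]
  refine Finset.sum_eq_zero fun j _ ↦ ?_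
  have : (a i ≫ b i) ≫ f ≫ c j ≫ d j = a i ≫ (b i ≫ f ≫ c j) ≫ d j := by
    simp only [Category.assoc]
  rw [this, hTS (b i ≫ f ≫ c j), zero_comp, comp_zero]

/-- A functor between triangulated categories preserves tilting objects if it has a partial
inverse up to direct summands. -/
lemma IsTilting.map (F : C ⥤ D) (R : D ⥤ C) [F.CommShift ℤ] [F.IsTriangulated] [R.CommShift ℤ]
    [R.IsTriangulated] {T : C} (hT : IsTilting T) (hRF : addClosure T (R.obj (F.obj T)))
    (hR : ∀ ⦃X Y : D⦄ (f : X ⟶ Y), R.map f = 0 → f = 0)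
    (hFR : ∀ Y : D, Nonempty (Retract Y (F.obj (R.obj Y)))) : IsTilting (F.obj T) := by
  refine ⟨?_, fun i hi f ↦ hR f ?_⟩
  -- The preimage of `P` under `F` is thick and contains `T`, hence `R.obj Y`; then `Y` is a summand
  -- of an object of `P`.
  · rw [eq_top_iff]
    rintro Y - P hP hP' hPT
    have : (P.inverseImage F).IsStableUnderRetracts :=
      ⟨fun r h ↦ P.prop_of_retract (r.map F) h⟩
    have hRY : (⊤ : ObjectProperty C) (R.obj Y) := trivial
    rw [← hT.1] at hRY
    exact P.prop_of_retract (hFR Y).some (hRY (P.inverseImage F) inferInstance inferInstance hPT)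
  -- After identifying `R ((F T)[i])` with `(R (F T))[i]`, the map `R f` goes from `add T` to `add
  -- (T[i])`.
  · have h := addClosure.hom_eq_zero (hT.2 i hi) hRF (addClosure.map (shiftFunctor C i) hRF)
      (R.map f ≫ (R.commShiftIso i).hom.app (F.obj T))
    rw [← cancel_mono ((R.commShiftIso i).hom.app (F.obj T)), h, zero_comp]

end AddClosure

/-- By naturality `f` is recovered from `G.map f` as `r.i ≫ G.map f ≫ r.r`. Applied to a composite
`G`, it shows that the first functor of the composite is faithful. -/
lemma CategoryTheory.Functor.eq_zero_of_retract {C : Type*} [Category* C] [Preadditive C]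
    {G : C ⥤ C} (r : Retract (𝟭 C) G) {X Y : C} (f : X ⟶ Y) (h : G.map f = 0) : f = 0 := by
  have hr : r.i.app Y ≫ r.r.app Y = 𝟙 Y := NatTrans.congr_app r.retract Y
  have hn : f ≫ r.i.app Y = r.i.app X ≫ G.map f := r.i.naturality f
  rw [← Category.comp_id f, ← hr, ← Category.assoc, hn, h, comp_zero, zero_comp]

/-- The objectwise retractions given by a retraction of functors. -/
def CategoryTheory.Retract.app {C D : Type*} [Category* C] [Category* D] {F G : C ⥤ D}
    (r : Retract F G) (X : C) : Retract (F.obj X) (G.obj X) :=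
  r.map ((evaluation C D).obj X)

section

variable {C : Type u₁} [Category.{v₁} C] [Abelian C] [HasDerivedCategory.{w₁} C]
  {D : Type u₂} [Category.{v₂} D] [Abelian D] [HasDerivedCategory.{w₂} D]
  {F : C ⥤ D} [F.Additive] [PreservesFiniteLimits F] [PreservesFiniteColimits F]
  {R : D ⥤ C} [R.Additive] [PreservesFiniteLimits R] [PreservesFiniteColimits R]

/-- If the identity is a retract of a composition of exact functors, the same is true for the
functors on bounded derived categories. -/
def retractMapBounded (r : Retract (𝟭 C) (F ⋙ R)) :
    Retract (𝟭 (DerivedCategory.Bounded C)) (mapBounded F ⋙ mapBounded R) where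
  i := mapBoundedId.inv ≫ mapBoundedNat r.i ≫ (mapBoundedComp (Iso.refl (F ⋙ R))).inv
  r := (mapBoundedComp (Iso.refl (F ⋙ R))).hom ≫ mapBoundedNat r.r ≫ mapBoundedId.hom
  retract := by
    have : mapBoundedNat r.i ≫ mapBoundedNat r.r = 𝟙 _ := by
      rw [← mapBoundedNat_comp, r.retract, mapBoundedNat_id]
    simp only [Category.assoc, Iso.inv_hom_id_assoc]
    rw [reassoc_of% this, Iso.inv_hom_id]

/-- The decomposition of `F ⋙ R` factors the identity of the image of `X` through the `t i`-images,
each of which `e` replaces by `X`. -/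
lemma addClosure_mapBounded {ι : Type*} [Fintype ι] (t : ι → (C ⥤ C)) [∀ i, (t i).Additive]
    [∀ i, PreservesFiniteLimits (t i)] [∀ i, PreservesFiniteColimits (t i)]
    (p : ∀ i, F ⋙ R ⟶ t i) (j : ∀ i, t i ⟶ F ⋙ R) (h : ∑ i, p i ≫ j i = 𝟙 (F ⋙ R))
    (X : DerivedCategory.Bounded C) (e : ∀ i, Nonempty ((mapBounded (t i)).obj X ≅ X)) :
    addClosure X ((mapBounded R).obj ((mapBounded F).obj X)) := by
  let c := (mapBoundedComp (Iso.refl (F ⋙ R))).app X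
  have hX : addClosure X ((mapBounded (F ⋙ R)).obj X) := by
    refine addClosure_of_sum (fun i ↦ (mapBoundedNat (p i)).app X ≫ (e i).some.hom)
      (fun i ↦ (e i).some.inv ≫ (mapBoundedNat (j i)).app X) ?_
    have h' := congrArg mapBoundedNat h
    rw [mapBoundedNat_sum, mapBoundedNat_id] at h'
    replace h' := NatTrans.congr_app h' X
    rw [NatTrans.app_sum] at h'
    refine Eq.trans (Finset.sum_congr rfl fun i _ ↦ ?_) h'
    rw [mapBoundedNat_comp]
    simp
  exact (addClosure_of_retract (Retract.ofIso c)).trans hX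

end

/-! ### Twisted Casimir maps, characters and the skew group algebra -/

section

variable {k : Type u} [Field k] {A B : Type u} [Ring A] [Algebra k A] [Ring B] [Algebra k B]
  [Module.Finite k B]

lemma tmul_smul_smul_eq (φ : A →ₐ[k] B) (N : RMod k B) (n : FGModuleCat.carrier N)
    {x x' y y' s r : Bᵐᵒᵖ} {t : Aᵐᵒᵖ} (h₁ : y * s = opHom φ t * y')
    (h₂ : x * opHom φ t = r * x') :
    ExtScalars.tmul (opHom φ) (M := FGModuleCat.carrier ((resFunctor φ).obj N)) x (y • s • n) =
      r • ExtScalars.tmul (opHom φ) (M := FGModuleCat.carrier ((resFunctor φ).obj N)) x'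
        (y' • n) := by
  have h₃ : y • s • n = opHom φ t • y' • n := by rw [smul_smul, h₁, mul_smul]
  rw [h₃]
  exact (ExtScalars.mul_tmul (opHom φ) (M := FGModuleCat.carrier ((resFunctor φ).obj N)) x t
    (y' • n)).symm.trans (congrArg (fun s ↦ ExtScalars.tmul (opHom φ)
      (M := FGModuleCat.carrier ((resFunctor φ).obj N)) s (y' • n)) h₂)

/-- Linearity is checked termwise after reindexing by `e`: `s` moves past `y (e i)`, leaving an
element of `A` that crosses the tensor sign and turns `x (e i)` into `r * x i`. -/
lemma casimirHom_smul {ι : Type*} [Fintype ι] (φ : A →ₐ[k] B) (x y : ι → Bᵐᵒᵖ) (e : ι ≃ ι)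
    (s r : Bᵐᵒᵖ) (t : ι → Aᵐᵒᵖ) (h₁ : ∀ i, y (e i) * s = opHom φ (t i) * y i)
    (h₂ : ∀ i, x (e i) * opHom φ (t i) = r * x i) (N : RMod k B) (n : FGModuleCat.carrier N) :
    casimirHom φ x y N (s • n) = r • casimirHom φ x y N n := by
  rw [casimirHom_apply, casimirHom_apply, Finset.smul_sum]
  refine (e.sum_comp _).symm.trans (Finset.sum_congr rfl fun i _ ↦ ?_)
  exact tmul_smul_smul_eq φ N n (h₁ i) (h₂ i)

end

/-- Enough roots of unity give a character `ψ` with `ψ g ≠ 1`. Translation by `ψ` permutes the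
characters, so the sum is fixed by multiplication with `ψ g`. -/
lemma sum_character_eq_zero {k G : Type*} [Field k] [CommGroup G] [Finite G]
    (hroots : HasEnoughRootsOfUnity k (Monoid.exponent G))
    [Fintype (G →* kˣ)] {g : G} (hg : g ≠ 1) : ∑ χ : G →* kˣ, (χ g : k) = 0 := by
  have : NeZero (Monoid.exponent G) := ⟨Monoid.exponent_ne_zero_of_finite⟩
  obtain ⟨ψ, hψ⟩ := CommGroup.exists_apply_ne_one_of_hasEnoughRootsOfUnity G k hg
  have h : (ψ g : k) * ∑ χ : G →* kˣ, (χ g : k) = ∑ χ : G →* kˣ, (χ g : k) := by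
    rw [Finset.mul_sum, ← Equiv.sum_comp (Equiv.mulLeft ψ) fun χ : G →* kˣ ↦ (χ g : k)]
    simp
  by_contra h0
  exact hψ (Units.ext (mul_right_cancel₀ h0 (h.trans (one_mul _).symm)))

section Skew

variable {k Λ G : Type u} [Field k] [Ring Λ] [Algebra k Λ]
    [CommGroup G] [MulSemiringAction G Λ] [SMulCommClass G k Λ]

/-- Since `(λ ⊗ g)(a ⊗ 1) = λ g(a) ⊗ g`, the coordinate at `g` is linear into the twist by `g`. -/
lemma skewBasis_c_mul [Fintype G] [DecidableEq G] (g : G) (a : Λᵐᵒᵖ)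
    (s : (SkewMonoidAlgebra Λ G)ᵐᵒᵖ) :
    (skewBasis k Λ G).c g (opHom (skewIncl k Λ G) a * s) =
      opHom (MulSemiringAction.toAlgAut G k Λ g : Λ →ₐ[k] Λ) a * (skewBasis k Λ G).c g s := by
  apply MulOpposite.unop_injective
  change (s.unop * SkewMonoidAlgebra.single 1 a.unop).coeff g = s.unop.coeff g * g • a.unop
  rw [SkewMonoidAlgebra.coeff_mul_single_one]

lemma mul_skewBasis_b [Fintype G] [DecidableEq G] (g : G) (a : Λᵐᵒᵖ) :
    opHom (skewIncl k Λ G) a * (skewBasis k Λ G).b g = (skewBasis k Λ G).b g *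
      opHom (skewIncl k Λ G)
        (opHom (MulSemiringAction.toAlgAut G k Λ g : Λ →ₐ[k] Λ) a) := by
  apply MulOpposite.unop_injective
  change SkewMonoidAlgebra.single g 1 * SkewMonoidAlgebra.single 1 a.unop =
    SkewMonoidAlgebra.single 1 (g • a.unop) * SkewMonoidAlgebra.single g 1
  simp [SkewMonoidAlgebra.single_mul_single]

lemma dualAction_skewIncl (χ : G →* kˣ) (a : Λ) :
    dualAction k Λ G χ (skewIncl k Λ G a) = skewIncl k Λ G a := by
  change dualAction k Λ G χ (SkewMonoidAlgebra.single 1 a) = SkewMonoidAlgebra.single 1 a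
  simp [dualAction_single]

/-- The group elements as units of the skew group algebra. -/
def skewUnit : G →* (SkewMonoidAlgebra Λ G)ˣ :=
  (Units.map (SkewMonoidAlgebra.of Λ G)).comp (toUnits (G := G)).toMonoidHom

/-- The action of `g` on `Λ` becomes conjugation by `1 ⊗ g` in `ΛG`; this is the input for
`resTwist`. -/
lemma skewIncl_mul_skewUnit (g : G) (a : Λ) :
    skewIncl k Λ G (MulSemiringAction.toAlgAut G k Λ g a) * (skewUnit (Λ := Λ) g : SkewMonoidAlgebra Λ G) =
      (skewUnit (Λ := Λ) g : SkewMonoidAlgebra Λ G) * skewIncl k Λ G a := by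
  change SkewMonoidAlgebra.single 1 (g • a) * SkewMonoidAlgebra.single g 1 =
    SkewMonoidAlgebra.single g 1 * SkewMonoidAlgebra.single 1 a
  simp [SkewMonoidAlgebra.single_mul_single]

variable [Finite G] [Module.Finite k Λ]

lemma skewCasimir_smul [Fintype G] (χ : G →* kˣ) (c : G → k)
    (hc : ∀ g h, (χ h : k) * c (g * h) = c g) (N : RMod k (SkewMonoidAlgebra Λ G))
    (r : (SkewMonoidAlgebra Λ G)ᵐᵒᵖ) (n : FGModuleCat.carrier N) :
    casimirHom (skewIncl k Λ G)
        (fun g ↦ MulOpposite.op (SkewMonoidAlgebra.single g (c g • (1 : Λ))))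
        (fun g ↦ MulOpposite.op (SkewMonoidAlgebra.single g⁻¹ (1 : Λ))) N
        (opHom (dualAction k Λ G χ : SkewMonoidAlgebra Λ G →ₐ[k] SkewMonoidAlgebra Λ G) r • n) =
      r • casimirHom (skewIncl k Λ G)
        (fun g ↦ MulOpposite.op (SkewMonoidAlgebra.single g (c g • (1 : Λ))))
        (fun g ↦ MulOpposite.op (SkewMonoidAlgebra.single g⁻¹ (1 : Λ))) N n := by
  obtain ⟨s, rfl⟩ := MulOpposite.op_surjective r
  induction s using SkewMonoidAlgebra.induction_on with
  | zero => rw [MulOpposite.op_zero, map_zero, zero_smul, zero_smul, map_zero]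
  | add s t hs ht => rw [MulOpposite.op_add, map_add, add_smul, add_smul, map_add, hs, ht]
  | single h a =>
    -- Reindex by `g ↦ g h`. As `χ(h) (a ⊗ h)(1 ⊗ (gh)⁻¹) = (1 ⊗ g⁻¹)(χ(h) g(a) ⊗ 1)`, the element
    -- crossing the tensor sign is `χ(h) g(a)`, and `hc` absorbs the scalar `χ(h)`.
    refine casimirHom_smul _ _ _ (Equiv.mulRight h) _ _
      (fun g ↦ MulOpposite.op ((χ h : k) • g • a)) (fun g ↦ ?_) (fun g ↦ ?_) N n
    · apply MulOpposite.unop_injective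
      change dualAction k Λ G χ (SkewMonoidAlgebra.single h a) *
          SkewMonoidAlgebra.single (g * h)⁻¹ 1 =
        SkewMonoidAlgebra.single g⁻¹ 1 * SkewMonoidAlgebra.single 1 ((χ h : k) • g • a)
      rw [dualAction_single, SkewMonoidAlgebra.single_mul_single,
        SkewMonoidAlgebra.single_mul_single, smul_comm (g⁻¹ : G) (χ h : k)]
      simp
    · apply MulOpposite.unop_injective
      change SkewMonoidAlgebra.single 1 ((χ h : k) • g • a) *
          SkewMonoidAlgebra.single (g * h) (c (g * h) • (1 : Λ)) =
        SkewMonoidAlgebra.single g (c g • (1 : Λ)) * SkewMonoidAlgebra.single h a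
      rw [SkewMonoidAlgebra.single_mul_single, SkewMonoidAlgebra.single_mul_single, ← hc g h]
      simp [smul_smul, mul_comm]

end Skew

/-! ### Induction and restriction of invariant tilting objects -/

section SkewTilting

variable {k Λ G : Type u} [Field k] [Ring Λ] [Algebra k Λ] [CommGroup G]
  [MulSemiringAction G Λ] [SMulCommClass G k Λ] [Finite G] [Module.Finite k Λ]

/-- A `Λ`-module `M` is a natural direct summand of `Res (M ⊗_Λ ΛG)`. -/
def retractIndRes [Fintype G] [DecidableEq G] :
    Retract (𝟭 (RMod k Λ)) (indFunctor (skewIncl k Λ G) ⋙ resFunctor (skewIncl k Λ G)) where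
  i := (resFunctorId (MulSemiringAction.toAlgAut G k Λ 1 : Λ →ₐ[k] Λ) (by
      rw [map_one]; rfl)).inv ≫ basisNat (skewBasis k Λ G) 1 _ (mul_skewBasis_b 1)
  r := coordNat (skewBasis k Λ G) 1 _ (skewBasis_c_mul 1) ≫
    (resFunctorId (MulSemiringAction.toAlgAut G k Λ 1 : Λ →ₐ[k] Λ) (by
      rw [map_one]; rfl)).hom
  retract := by
    rw [Category.assoc, reassoc_of% basisNat_coordNat, Iso.inv_hom_id]

/-- The coefficients `χ(g)⁻¹ / |G|`. -/
def casimirCoeff (k : Type*) {G : Type*} [Field k] [CommGroup G] (χ : G →* kˣ) (g : G) : k :=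
  (Nat.card G : k)⁻¹ * ((χ g)⁻¹ : kˣ)

lemma casimirCoeff_mul {k G : Type*} [Field k] [CommGroup G] (χ : G →* kˣ) (g h : G) :
    (χ h : k) * casimirCoeff k χ (g * h) = casimirCoeff k χ g := by
  have : (χ h : k) ≠ 0 := Units.ne_zero _
  simp only [casimirCoeff, map_mul, mul_inv_rev, Units.val_mul, Units.val_inv_eq_inv_val]
  field_simp

/-- The map from the twist of `N` by `χ` to `(Res N) ⊗_Λ ΛG`. -/
def charInclusion [Fintype G] (χ : G →* kˣ) :
    resFunctor (dualAction k Λ G χ : SkewMonoidAlgebra Λ G →ₐ[k] SkewMonoidAlgebra Λ G) ⟶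
      resFunctor (skewIncl k Λ G) ⋙ indFunctor (skewIncl k Λ G) :=
  casimirNat (skewIncl k Λ G) _ _ _ (skewCasimir_smul χ (casimirCoeff k χ) (casimirCoeff_mul χ))

/-- The map from `(Res N) ⊗_Λ ΛG` to the twist of `N` by `χ`. -/
def charProjection (χ : G →* kˣ) :
    resFunctor (skewIncl k Λ G) ⋙ indFunctor (skewIncl k Λ G) ⟶
      resFunctor (dualAction k Λ G χ : SkewMonoidAlgebra Λ G →ₐ[k] SkewMonoidAlgebra Λ G) :=
  actNat (skewIncl k Λ G) _ (dualAction_skewIncl χ)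

/-- Applying `χ` cancels the factor `χ(g)⁻¹`, so each of the `|G|` summands is `1/|G|`. -/
lemma charInclusion_charProjection [Fintype G] (hG : (Nat.card G : k) ≠ 0) (χ : G →* kˣ) :
    charInclusion (Λ := Λ) χ ≫ charProjection χ = 𝟙 _ := by
  refine casimirNat_actNat _ _ _ _ _ _ ?_
  apply MulOpposite.unop_injective
  rw [Finset.unop_sum]
  have (g : G) : SkewMonoidAlgebra.single g⁻¹ (1 : Λ) * dualAction k Λ G χ
      (SkewMonoidAlgebra.single g (casimirCoeff k χ g • (1 : Λ))) =
        SkewMonoidAlgebra.single 1 ((Nat.card G : k)⁻¹ • (1 : Λ)) := by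
    rw [dualAction_single, SkewMonoidAlgebra.single_mul_single, smul_smul,
      smul_comm (g⁻¹ : G), smul_one, one_mul, inv_mul_cancel, casimirCoeff]
    congr 2
    rw [mul_left_comm, Units.mul_inv, mul_one]
  refine (Finset.sum_congr rfl fun g _ ↦ this g).trans ?_
  rw [Finset.sum_const, Finset.card_univ, ← Nat.card_eq_fintype_card,
    ← SkewMonoidAlgebra.smul_single, ← Nat.cast_smul_eq_nsmul k, smul_smul,
    mul_inv_cancel₀ hG, one_smul]
  rfl

/-- The total coefficient of the term at `g` is `(1/|G|) ∑ χ, χ(g⁻¹)`. It vanishes for `g ≠ 1` by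
orthogonality and equals `1` for `g = 1` because there are `|G|` characters. -/
lemma sum_charProjection_charInclusion [Fintype G] [Fintype (G →* kˣ)]
    (hG : (Nat.card G : k) ≠ 0) (hroots : HasEnoughRootsOfUnity k (Monoid.exponent G)) :
    ∑ χ : G →* kˣ, charProjection (Λ := Λ) χ ≫ charInclusion χ = 𝟙 _ := by
  have : NeZero (Monoid.exponent G) := ⟨Monoid.exponent_ne_zero_of_finite⟩
  have key (g : G) : ∑ χ : G →* kˣ, MulOpposite.op
      (SkewMonoidAlgebra.single g (casimirCoeff k χ g • (1 : Λ))) =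
      MulOpposite.op (SkewMonoidAlgebra.single g
        (((Nat.card G : k)⁻¹ * ∑ χ : G →* kˣ, (χ g⁻¹ : k)) • (1 : Λ))) := by
    let f : k →+ (SkewMonoidAlgebra Λ G)ᵐᵒᵖ := AddMonoidHom.mk'
      (fun c ↦ MulOpposite.op (SkewMonoidAlgebra.single g (c • (1 : Λ))))
      (fun c d ↦ by rw [add_smul, SkewMonoidAlgebra.single_add, MulOpposite.op_add])
    rw [Finset.mul_sum]
    refine Eq.trans (Finset.sum_congr rfl fun χ _ ↦ ?_) (map_sum f _ _).symm
    rw [map_inv]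
    rfl
  refine sum_actNat_casimirNat _ _ _ _ _ _ 1 ?_ ?_ fun g hg ↦ ?_
  · rw [inv_one]; rfl
  · refine (key 1).trans ?_
    simp only [inv_one, map_one, Units.val_one, Finset.sum_const, Finset.card_univ,
      nsmul_eq_mul, mul_one]
    rw [← Nat.card_eq_fintype_card, CommGroup.card_monoidHom_of_hasEnoughRootsOfUnity,
      inv_mul_cancel₀ hG, one_smul]
    rfl
  · refine (key g).trans ?_
    rw [sum_character_eq_zero hroots (inv_ne_one.2 hg), mul_zero, zero_smul,
      SkewMonoidAlgebra.single_zero, MulOpposite.op_zero]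

/-- A `ΛG`-module `N` is a natural direct summand of `(Res N) ⊗_Λ ΛG`. -/
def retractResInd [Fintype G] (hG : (Nat.card G : k) ≠ 0) :
    Retract (𝟭 (RMod k (SkewMonoidAlgebra Λ G)))
      (resFunctor (skewIncl k Λ G) ⋙ indFunctor (skewIncl k Λ G)) where
  i := (resFunctorId (dualAction k Λ G 1 :
      SkewMonoidAlgebra Λ G →ₐ[k] SkewMonoidAlgebra Λ G) (by rw [map_one]; rfl)).inv ≫
    charInclusion 1
  r := charProjection 1 ≫ (resFunctorId (dualAction k Λ G 1 :
      SkewMonoidAlgebra Λ G →ₐ[k] SkewMonoidAlgebra Λ G) (by rw [map_one]; rfl)).hom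
  retract := by
    rw [Category.assoc, reassoc_of% charInclusion_charProjection hG, Iso.inv_hom_id]

lemma IsInvariantObj.nonempty_iso {A : Type u} [Ring A] [Algebra k A] [Module.Finite k A]
    [HasDerivedCategory.{w} (RMod k A)] {H : Type*} [Group H] {ρ : H →* (A ≃ₐ[k] A)}
    {X : Db k A} (hX : IsInvariantObj ρ X) (h : H) : Nonempty ((twist (ρ h)).obj X ≅ X) := by
  obtain ⟨ι, -⟩ := hX
  -- The isomorphism `ι g` starts at the twist by `g⁻¹`, hence the index `h⁻¹`.
  exact ⟨eqToIso (by rw [inv_inv]) ≪≫ ι h⁻¹⟩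

variable [HasDerivedCategory.{w₁} (RMod k Λ)]
  [HasDerivedCategory.{w₂} (RMod k (SkewMonoidAlgebra Λ G))]

instance : (skewInd k Λ G).CommShift ℤ :=
  inferInstanceAs ((mapBounded (indFunctor (skewIncl k Λ G))).CommShift ℤ)

instance : (skewInd k Λ G).IsTriangulated :=
  inferInstanceAs (mapBounded (indFunctor (skewIncl k Λ G))).IsTriangulated

instance : (skewRes k Λ G).CommShift ℤ :=
  inferInstanceAs ((mapBounded (resFunctor (skewIncl k Λ G))).CommShift ℤ)

instance : (skewRes k Λ G).IsTriangulated :=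
  inferInstanceAs (mapBounded (resFunctor (skewIncl k Λ G))).IsTriangulated

variable (k Λ G) in
lemma nonempty_retract_skewInd_skewRes :
    Nonempty (Retract (𝟭 (Db k Λ)) (skewInd k Λ G ⋙ skewRes k Λ G)) := by
  classical
  have := Fintype.ofFinite G
  exact ⟨retractMapBounded retractIndRes⟩

variable (Λ) in
lemma nonempty_retract_skewRes_skewInd (hG : (Nat.card G : k) ≠ 0) :
    Nonempty (Retract (𝟭 (Db k (SkewMonoidAlgebra Λ G))) (skewRes k Λ G ⋙ skewInd k Λ G)) := by
  have := Fintype.ofFinite G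
  exact ⟨retractMapBounded (retractResInd hG)⟩

lemma addClosure_skewRes_skewInd {T : Db k Λ}
    (hT : IsInvariantObj (MulSemiringAction.toAlgAut G k Λ) T) :
    addClosure T ((skewRes k Λ G).obj ((skewInd k Λ G).obj T)) := by
  classical
  have := Fintype.ofFinite G
  exact addClosure_mapBounded _ _ _
    (sum_coordNat_basisNat (skewBasis k Λ G) _ skewBasis_c_mul mul_skewBasis_b) T
    hT.nonempty_iso

lemma addClosure_skewInd_skewRes (hG : (Nat.card G : k) ≠ 0)
    (hroots : HasEnoughRootsOfUnity k (Monoid.exponent G)) {U : Db k (SkewMonoidAlgebra Λ G)}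
    (hU : IsInvariantObj (dualAction k Λ G) U) :
    addClosure U ((skewInd k Λ G).obj ((skewRes k Λ G).obj U)) := by
  have := Fintype.ofFinite G
  have : NeZero (Monoid.exponent G) := ⟨Monoid.exponent_ne_zero_of_finite⟩
  have : Finite (G →* kˣ) := Finite.of_equiv G
    (CommGroup.monoidHom_mulEquiv_of_hasEnoughRootsOfUnity G k).some.symm.toEquiv
  have := Fintype.ofFinite (G →* kˣ)
  exact addClosure_mapBounded _ _ _ (sum_charProjection_charInclusion hG hroots) U
    hU.nonempty_iso

lemma isInvariantObj_skewInd (T : Db k Λ) :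
    IsInvariantObj (dualAction k Λ G) ((skewInd k Λ G).obj T) :=
  ⟨fun χ ↦ (mapBoundedComp (indTwist (skewIncl k Λ G) (dualAction k Λ G χ⁻¹)
      (dualAction_skewIncl χ⁻¹))).app T,
    fun χ ψ ↦ mapBoundedComp_assoc _ _ _ _
      (indTwist_comp (skewIncl k Λ G) (dualAction k Λ G ψ⁻¹) (dualAction k Λ G χ⁻¹)
        (dualAction k Λ G (χ * ψ)⁻¹)
        ((congrArg _ (mul_inv_rev χ ψ)).trans (map_mul _ _ _)) _ _ _ _) T⟩

lemma isInvariantObj_skewRes (U : Db k (SkewMonoidAlgebra Λ G)) :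
    IsInvariantObj (MulSemiringAction.toAlgAut G k Λ) ((skewRes k Λ G).obj U) :=
  ⟨fun g ↦ (mapBoundedComp (resTwist (skewIncl k Λ G) (MulSemiringAction.toAlgAut G k Λ g⁻¹)
      (skewUnit g⁻¹) (skewIncl_mul_skewUnit g⁻¹))).app U,
    fun g h ↦ mapBoundedComp_assoc _ _ _ _
      (resTwist_comp (skewIncl k Λ G) (MulSemiringAction.toAlgAut G k Λ h⁻¹)
        (MulSemiringAction.toAlgAut G k Λ g⁻¹) (MulSemiringAction.toAlgAut G k Λ (g * h)⁻¹)
        (skewUnit h⁻¹) (skewUnit g⁻¹) (skewUnit (g * h)⁻¹) (by rw [mul_inv_rev, map_mul])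
        _ _ _ _) U⟩

/-- The retraction serves twice: it makes restriction faithful, and it exhibits every object as a
summand of an induced one. -/
lemma isInvariantTilting_skewInd (hG : (Nat.card G : k) ≠ 0) {T : Db k Λ}
    (hT : IsInvariantTilting (MulSemiringAction.toAlgAut G k Λ) T) :
    IsInvariantTilting (dualAction k Λ G) ((skewInd k Λ G).obj T) := by
  obtain ⟨r⟩ := nonempty_retract_skewRes_skewInd Λ hG
  refine ⟨hT.1.map _ (skewRes k Λ G) (addClosure_skewRes_skewInd hT.2) (fun X Y f hf ↦
    Functor.eq_zero_of_retract r f ?_) (fun Y ↦ ⟨r.app Y⟩), isInvariantObj_skewInd T⟩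
  rw [Functor.comp_map, hf, Functor.map_zero]

lemma isInvariantTilting_skewRes (hG : (Nat.card G : k) ≠ 0)
    (hroots : HasEnoughRootsOfUnity k (Monoid.exponent G)) {U : Db k (SkewMonoidAlgebra Λ G)}
    (hU : IsInvariantTilting (dualAction k Λ G) U) :
    IsInvariantTilting (MulSemiringAction.toAlgAut G k Λ) ((skewRes k Λ G).obj U) := by
  obtain ⟨r⟩ := nonempty_retract_skewInd_skewRes k Λ G
  refine ⟨hU.1.map _ (skewInd k Λ G) (addClosure_skewInd_skewRes hG hroots hU.2)
    (fun X Y f hf ↦ Functor.eq_zero_of_retract r f ?_) (fun Y ↦ ⟨r.app Y⟩),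
    isInvariantObj_skewRes U⟩
  rw [Functor.comp_map, hf, Functor.map_zero]

lemma addClosure_skewRes_skewInd_eq {T : Db k Λ}
    (hT : IsInvariantObj (MulSemiringAction.toAlgAut G k Λ) T) :
    addClosure ((skewRes k Λ G).obj ((skewInd k Λ G).obj T)) = addClosure T :=
  addClosure_eq (addClosure_of_retract ((nonempty_retract_skewInd_skewRes k Λ G).some.app T))
    (addClosure_skewRes_skewInd hT)

lemma addClosure_skewInd_skewRes_eq (hG : (Nat.card G : k) ≠ 0)
    (hroots : HasEnoughRootsOfUnity k (Monoid.exponent G)) {U : Db k (SkewMonoidAlgebra Λ G)}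
    (hU : IsInvariantObj (dualAction k Λ G) U) :
    addClosure ((skewInd k Λ G).obj ((skewRes k Λ G).obj U)) = addClosure U :=
  addClosure_eq (addClosure_of_retract ((nonempty_retract_skewRes_skewInd Λ hG).some.app U))
    (addClosure_skewInd_skewRes hG hroots hU)

end SkewTilting

end

/-! ### The bijection of tilting subcategories -/

theorem theorem2p8
    (k Λ G : Type u) [Field k] [Ring Λ] [Algebra k Λ] [Module.Finite k Λ]
    [CommGroup G] [Finite G] [MulSemiringAction G Λ] [SMulCommClass G k Λ]
    (hchar : ¬ ringChar k ∣ Nat.card G)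
    (hroots : HasEnoughRootsOfUnity k (Monoid.exponent G))
    [HasDerivedCategory.{w₁} (RMod k Λ)]
    [HasDerivedCategory.{w₂} (RMod k (SkewMonoidAlgebra Λ G))] :
    (∀ T : Db k Λ, IsInvariantTilting (MulSemiringAction.toAlgAut G k Λ) T →
      IsInvariantTilting (dualAction k Λ G) ((skewInd k Λ G).obj T)) ∧
    (∀ U : Db k (SkewMonoidAlgebra Λ G), IsInvariantTilting (dualAction k Λ G) U →
      IsInvariantTilting (MulSemiringAction.toAlgAut G k Λ) ((skewRes k Λ G).obj U)) ∧
    ∃ e : TiltingSubcat (MulSemiringAction.toAlgAut G k Λ) ≃ TiltingSubcat (dualAction k Λ G),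
      (∀ (T : Db k Λ) (hT : IsInvariantTilting (MulSemiringAction.toAlgAut G k Λ) T),
        (e ⟨addClosure T, T, hT, rfl⟩ : ObjectProperty (Db k (SkewMonoidAlgebra Λ G))) =
          addClosure ((skewInd k Λ G).obj T)) ∧
      (∀ (U : Db k (SkewMonoidAlgebra Λ G)) (hU : IsInvariantTilting (dualAction k Λ G) U),
        (e.symm ⟨addClosure U, U, hU, rfl⟩ : ObjectProperty (Db k Λ)) =
          addClosure ((skewRes k Λ G).obj U)) := by
  have hG : (Nat.card G : k) ≠ 0 := fun h ↦ hchar ((ringChar.spec k _).1 h)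
  have hF {T : Db k Λ} (hT : IsInvariantTilting (MulSemiringAction.toAlgAut G k Λ) T) :=
    isInvariantTilting_skewInd hG hT
  have hR {U : Db k (SkewMonoidAlgebra Λ G)} (hU : IsInvariantTilting (dualAction k Λ G) U) :=
    isInvariantTilting_skewRes hG hroots hU
  -- Both maps use a chosen invariant tilting generator; `addClosure_map_eq` makes the result
  -- independent of the choice.
  let e : TiltingSubcat (MulSemiringAction.toAlgAut G k Λ) ≃ TiltingSubcat (dualAction k Λ G) :=
    { toFun := fun P ↦ ⟨addClosure ((skewInd k Λ G).obj P.2.choose), _,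
        hF P.2.choose_spec.1, rfl⟩
      invFun := fun P ↦ ⟨addClosure ((skewRes k Λ G).obj P.2.choose), _,
        hR P.2.choose_spec.1, rfl⟩
      left_inv := fun P ↦ Subtype.ext (by
        -- By proof irrelevance, `h.choose` is the very generator that `invFun` picks for the image
        -- of `P`.
        have h : ∃ U, IsInvariantTilting (dualAction k Λ G) U ∧
          addClosure ((skewInd k Λ G).obj P.2.choose) = addClosure U :=
            ⟨_, hF P.2.choose_spec.1, rfl⟩
        refine (addClosure_map_eq (skewRes k Λ G) h.choose_spec.2.symm).trans ?_
        exact (addClosure_skewRes_skewInd_eq P.2.choose_spec.1.2).trans P.2.choose_spec.2.symm)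
      right_inv := fun P ↦ Subtype.ext (by
        have h : ∃ T, IsInvariantTilting (MulSemiringAction.toAlgAut G k Λ) T ∧
          addClosure ((skewRes k Λ G).obj P.2.choose) = addClosure T :=
            ⟨_, hR P.2.choose_spec.1, rfl⟩
        refine (addClosure_map_eq (skewInd k Λ G) h.choose_spec.2.symm).trans ?_
        exact (addClosure_skewInd_skewRes_eq hG hroots P.2.choose_spec.1.2).trans
          P.2.choose_spec.2.symm) }
  refine ⟨fun _ ↦ hF, fun _ ↦ hR, e, fun T hT ↦ ?_, fun U hU ↦ ?_⟩
  · have h : ∃ T', IsInvariantTilting (MulSemiringAction.toAlgAut G k Λ) T' ∧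
      addClosure T = addClosure T' := ⟨T, hT, rfl⟩
    exact addClosure_map_eq (skewInd k Λ G) h.choose_spec.2.symm
  · have h : ∃ U', IsInvariantTilting (dualAction k Λ G) U' ∧
      addClosure U = addClosure U' := ⟨U, hU, rfl⟩
    exact addClosure_map_eq (skewRes k Λ G) h.choose_spec.2.symm
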